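/- Let $Q$ be a finite quiver (finitely many vertices $1,\dots,n$ and finitely many arrows, multiple arrows allowed) without oriented cycles, and let $k$ be an arbitrary field. Let $\operatorname{rep} Q$ be the category of finite-dimensional representations of $Q$ over $k$; for $V\in\operatorname{rep}Q$ let $\underline{\dim}\,V\in\mathbb Z^n$ be its dimension vector. On $\mathbb Z^n$ with standard basis $e_1,\dots,e_n$ consider the Euler–Ringel form $\langle\beta,\gamma\rangle=\sum_i\beta_i\gamma_i-\sum_{(a:i\to j)\in Q}\beta_i\gamma_j$ and its symmetrization $(\beta,\gamma)=\langle\beta,\gamma\rangle+\langle\gamma,\beta\rangle$. Let $s_i(\gamma)=\gamma-(e_i,\gamma)e_i$, and let the Weyl group $W$ be the group of automorphisms of $\mathbb Z^n$ generated by $s_1,\dots,s_n$. An expression $w=s_{j_1}\cdots s_{j_r}$ is reduced if $r$ is minimal among all such expressions for $w$. The inversion set of $w\in W$ is $\operatorname{inv}(w)=\{e_{j_1},\,s_{j_1}e_{j_2},\,\dots,\,s_{j_1}\cdots s_{j_{r-1}}e_{j_r}\}$ for a reduced expression $w=s_{j_1}\cdots s_{j_r}$; it does not depend on the reduced expression chosen.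 Let $c_Q=s_{i_1}\cdots s_{i_n}$ be the Coxeter element associated to $Q$, where $(i_1,\dots,i_n)$ is any ordering of the vertices in which $i$ precedes $j$ whenever there is an arrow $j\to i$. For $J\subseteq\{1,\dots,n\}$ let $c_J$ be the subword of $s_{i_1}\cdots s_{i_n}$ consisting of the letters $s_j$ with $j\in J$. An element $w\in W$ is $c_Q$-sortable if it has a reduced expression of the form $w=c_{J_1}c_{J_2}\cdots c_{J_m}$ with $J_1\supseteq J_2\supseteq\dots\supseteq J_m$. A torsion free class in $\operatorname{rep}Q$ is a full additive subcategory, closed under isomorphism, that is closed under extensions and subrepresentations; it is finite if it contains only finitely many indecomposable representations up to isomorphism. For $w\in W$ let $\mathcal F(w)$ be the full subcategory of $\operatorname{rep}Q$ whose objects are the representations isomorphic to finite direct sums of indecomposable representations with dimension vector in $\operatorname{inv}(w)$. **Theorem.** The map $w\mapsto\mathcal F(w)$ is a bijection from the set of $c_Q$-sortable elements of $W$ to the set of finite torsion free classes in $\operatorname{rep}Q$. -/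

import Mathlib

universe u v w

namespace QuiverTF

/-! ### Acyclic quivers and the Euler--Ringel form -/

/-- A quiver has no oriented cycles: every path from a vertex to itself is trivial. -/
class IsAcyclic (V : Type v) [Quiver.{w} V] : Prop where
  eq_nil : ∀ (i : V) (p : Quiver.Path i i), p = Quiver.Path.nil

theorem IsAcyclic.isEmpty_loop {V : Type v} [Quiver.{w} V] [IsAcyclic V] (i : V) :
    IsEmpty (i ⟶ i) :=
  ⟨fun a => by
    have h := congrArg Quiver.Path.length (IsAcyclic.eq_nil i a.toPath)
    simp at h⟩

/-- The Euler--Ringel form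
`⟨β, γ⟩ = ∑ i, β i * γ i - ∑ (arrows a : i ⟶ j), β i * γ j` on `ℤ^V`. -/
noncomputable def eulerForm (V : Type v) [Fintype V] [Quiver.{w} V] :
    LinearMap.BilinForm ℤ (V → ℤ) :=
  LinearMap.mk₂ ℤ
    (fun β γ => ∑ i, β i * γ i - ∑ i, ∑ j, (Nat.card (i ⟶ j) : ℤ) * (β i * γ j))
    (by intro β β' γ; simp only [Pi.add_apply, add_mul, mul_add, Finset.sum_add_distrib]; ring)
    (by
      intro r β γ
      simp only [Pi.smul_apply, smul_eq_mul, mul_sub, Finset.mul_sum]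
      simp only [mul_assoc, mul_left_comm])
    (by intro β γ γ'; simp only [Pi.add_apply, mul_add, Finset.sum_add_distrib]; ring)
    (by
      intro r β γ
      simp only [Pi.smul_apply, smul_eq_mul, mul_sub, Finset.mul_sum]
      simp only [mul_left_comm])

/-- The symmetrized form `(β, γ) = ⟨β, γ⟩ + ⟨γ, β⟩`. -/
noncomputable def symForm (V : Type v) [Fintype V] [Quiver.{w} V] :
    LinearMap.BilinForm ℤ (V → ℤ) :=
  eulerForm V + (eulerForm V).flip

/-- The standard basis vector `e_i` of `ℤ^V`. -/
def stdVec {V : Type v} [DecidableEq V] (i : V) : V → ℤ := Pi.single i 1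

section Weyl

variable {V : Type v} [Fintype V] [DecidableEq V] [Quiver.{w} V] [IsAcyclic V]

theorem symForm_stdVec_self (i : V) : symForm V (stdVec i) (stdVec i) = 2 := by
  have h := IsAcyclic.isEmpty_loop i
  simp [symForm, eulerForm, stdVec, Pi.single_apply]

/-! ### The Weyl group, reduced words and inversion sets -/

/-- The simple reflection `s_i(γ) = γ - 2 (e_i, γ) / (e_i, e_i) • e_i = γ - (e_i, γ) • e_i`
(as `(e_i, e_i) = 2`), as an automorphism of `ℤ^V`. -/
noncomputable def simpleReflection (i : V) : (V → ℤ) ≃ₗ[ℤ] (V → ℤ) :=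
  Module.reflection (symForm_stdVec_self i)

variable (V) in
/-- The Weyl group `W`: the group generated by the simple reflections. -/
noncomputable def weylGroup : Subgroup ((V → ℤ) ≃ₗ[ℤ] (V → ℤ)) :=
  Subgroup.closure (Set.range simpleReflection)

/-- The simple reflection `s_i` as an element of `W`. -/
noncomputable def simpleGen (i : V) : weylGroup V :=
  ⟨simpleReflection i, Subgroup.subset_closure ⟨i, rfl⟩⟩

/-- The product `s_{i_1} s_{i_2} ⋯ s_{i_r}` of a word `[i_1, …, i_r]`. -/
noncomputable def wordProd (ω : List V) : weylGroup V := (ω.map simpleGen).prod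

/-- A word is reduced if it has minimal length among all words with the same product. -/
def IsReduced (ω : List V) : Prop :=
  ∀ ω' : List V, wordProd ω' = wordProd ω → ω.length ≤ ω'.length

/-- The set `{e_{i_1}, s_{i_1} e_{i_2}, …, s_{i_1} ⋯ s_{i_{r-1}} e_{i_r}}` attached to a
word `[i_1, …, i_r]`. -/
def wordInv (ω : List V) : Set (V → ℤ) :=
  {β | ∃ (ω₁ ω₂ : List V) (i : V), ω = ω₁ ++ i :: ω₂ ∧
    β = (wordProd ω₁ : (V → ℤ) ≃ₗ[ℤ] (V → ℤ)) (stdVec i)}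

/-- The inversion set of `x ∈ W`: the set `wordInv ω` for a reduced word `ω` of `x`
(all reduced words of `x` yield the same set). -/
def inv (x : weylGroup V) : Set (V → ℤ) :=
  {β | ∃ ω : List V, IsReduced ω ∧ wordProd ω = x ∧ β ∈ wordInv ω}

/-! ### Coxeter words and sortable elements -/

/-- `c = [i_1, …, i_n]` lists every vertex exactly once, and `i` comes before `j` whenever
there is an arrow `j ⟶ i`, i.e. there is no arrow from an earlier entry to a later one.
Then `c_Q = s_{i_1} ⋯ s_{i_n}` is the Coxeter element associated to the quiver. -/
structure IsCoxeterWord {V : Type v} [Quiver.{w} V] (c : List V) : Prop where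
  nodup : c.Nodup
  mem : ∀ i : V, i ∈ c
  oriented : c.Pairwise fun i j => IsEmpty (i ⟶ j)

/-- `x ∈ W` is `c`-sortable: it has a reduced expression `c_{J_1} c_{J_2} ⋯ c_{J_k}` with
`J_1 ⊇ J_2 ⊇ ⋯ ⊇ J_k`, where `c_J` is the subword of `c` formed by the letters in `J`. -/
def IsSortable (c : List V) (x : weylGroup V) : Prop :=
  ∃ J : List (Finset V), J.Pairwise (fun A B => B ⊆ A) ∧
    IsReduced (J.flatMap fun A => c.filter (· ∈ A)) ∧
    wordProd (J.flatMap fun A => c.filter (· ∈ A)) = x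

/-- Every finite acyclic quiver has a Coxeter word. -/
theorem exists_isCoxeterWord (V : Type v) [Fintype V] [Quiver.{w} V] [IsAcyclic V] :
    ∃ c : List V, IsCoxeterWord c := by
  classical
  let r : V → V → Prop := fun a b => Nonempty (Quiver.Path b a)
  have hr : IsPartialOrder V r :=
    { refl := fun a => ⟨Quiver.Path.nil⟩
      trans := fun a b c ⟨p⟩ ⟨q⟩ => ⟨q.comp p⟩
      antisymm := by
        rintro a b ⟨p⟩ ⟨q⟩
        have h := congrArg Quiver.Path.length (IsAcyclic.eq_nil b (p.comp q))
        simp only [Quiver.Path.length_comp, Quiver.Path.length_nil] at h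
        exact (Quiver.Path.eq_of_length_zero p (by omega)).symm }
  obtain ⟨s, hs, hrs⟩ := extend_partialOrder r
  refine ⟨Finset.univ.sort s, Finset.sort_nodup _ _, fun i => by simp, ?_⟩
  have h1 := Finset.pairwise_sort (Finset.univ : Finset V) s
  have h2 : (Finset.univ.sort s).Nodup := Finset.sort_nodup _ _
  refine (h1.and h2).imp ?_
  rintro i j ⟨hij, hne⟩
  exact ⟨fun a => hne (antisymm_of s hij (hrs _ _ ⟨a.toPath⟩))⟩

end Weyl

end QuiverTF

/-! ### Finite-dimensional representations -/

/-- A finite-dimensional representation over `k` of a quiver with vertex set `V`. -/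
structure QuiverRep (k : Type u) [Field k] (V : Type v) [Quiver.{w} V] where
  space : V → Type u
  [addCommGroup : ∀ i, AddCommGroup (space i)]
  [module : ∀ i, Module k (space i)]
  [finite : ∀ i, Module.Finite k (space i)]
  map : ∀ {i j : V}, (i ⟶ j) → (space i →ₗ[k] space j)

namespace QuiverRep

attribute [instance] QuiverRep.addCommGroup QuiverRep.module QuiverRep.finite

variable {k : Type u} [Field k] {V : Type v} [Quiver.{w} V]

/-- Morphisms of representations. -/
structure Hom (X Y : QuiverRep k V) where
  app : ∀ i : V, X.space i →ₗ[k] Y.space i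
  comm : ∀ {i j : V} (a : i ⟶ j) (x : X.space i), app j (X.map a x) = Y.map a (app i x)

/-- Two representations are isomorphic if there is a morphism that is bijective at every
vertex. -/
def Isomorphic (X Y : QuiverRep k V) : Prop :=
  ∃ f : Hom X Y, ∀ i, Function.Bijective (f.app i)

/-- The zero representations. -/
def IsZero (X : QuiverRep k V) : Prop := ∀ i, Subsingleton (X.space i)

/-- The direct sum of two representations. -/
def prod (X Y : QuiverRep k V) : QuiverRep k V where
  space i := X.space i × Y.space i
  map a := (X.map a).prodMap (Y.map a)

/-- The direct sum of a finite family of representations. -/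
def directSum {n : ℕ} (Y : Fin n → QuiverRep k V) : QuiverRep k V where
  space i := ∀ m, (Y m).space i
  map a := LinearMap.pi fun m => ((Y m).map a).comp (LinearMap.proj m)

/-- A nonzero representation that is not a direct sum of two nonzero ones. -/
def Indecomposable (X : QuiverRep k V) : Prop :=
  ¬ X.IsZero ∧ ∀ A B : QuiverRep k V, Isomorphic X (A.prod B) → A.IsZero ∨ B.IsZero

/-- The dimension vector. -/
noncomputable def dimVec (X : QuiverRep k V) : V → ℤ :=
  fun i => (Module.finrank k (X.space i) : ℤ)

/-- Torsion free classes: full additive subcategories of `rep Q` (given by their sets of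
objects) closed under subrepresentations and extensions. Closure under isomorphism is part
of `sub_mem`, where `X` is a subrepresentation of `Y` up to isomorphism. -/
structure IsTorsionFreeClass (T : Set (QuiverRep k V)) : Prop where
  zero_mem : ∀ X : QuiverRep k V, X.IsZero → X ∈ T
  prod_mem : ∀ X Y : QuiverRep k V, X ∈ T → Y ∈ T → X.prod Y ∈ T
  sub_mem : ∀ (X Y : QuiverRep k V) (f : Hom X Y),
    (∀ i, Function.Injective (f.app i)) → Y ∈ T → X ∈ T
  ext_mem : ∀ (X Y Z : QuiverRep k V) (f : Hom X Y) (g : Hom Y Z),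
    (∀ i, Function.Injective (f.app i)) → (∀ i, Function.Exact (f.app i) (g.app i)) →
    (∀ i, Function.Surjective (g.app i)) → X ∈ T → Z ∈ T → Y ∈ T

/-- The class contains only finitely many indecomposables up to isomorphism. -/
def IsFiniteClass (T : Set (QuiverRep k V)) : Prop :=
  ∃ S : Set (QuiverRep k V), S.Finite ∧
    ∀ X ∈ T, X.Indecomposable → ∃ Y ∈ S, Isomorphic X Y

variable (k) in
/-- `F(x)`: the direct sums of (finitely many copies of) indecomposable representations whose
dimension vectors lie in the inversion set of `x`. -/
def classOf [Fintype V] [DecidableEq V] [QuiverTF.IsAcyclic V]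
    (x : QuiverTF.weylGroup V) : Set (QuiverRep k V) :=
  {X | ∃ (n : ℕ) (Y : Fin n → QuiverRep k V),
    (∀ m, (Y m).Indecomposable ∧ (Y m).dimVec ∈ QuiverTF.inv x) ∧
    Isomorphic X (directSum Y)}

end QuiverRep

/-! The proof is an induction by Bernstein–Gelfand–Ponomarev reflections, run in parallel on words,
on roots and on torsion free classes. Let `i` be the first letter of the Coxeter word, so that `i`
is a sink.

Words: a sortable word either drops `i` for good and is sortable for the remaining letters, or it
begins with `i` and its rest is sortable for the Coxeter word with `i` moved to the end
(`isSortable_iff`).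

Roots: prepending `s_i` to a reduced word, when the result is again reduced, replaces the inversion
set `R` by `{e_i} ∪ s_i R`; reducedness means exactly that `e_i ∉ R` (`isReduced_cons_iff`). This
rests on the fact that every real root is positive or negative.

Classes: a torsion free class either vanishes at `i`, or contains the simple representation `S_i`,
because any vector at a sink spans a subrepresentation. In the second case reflection at `i`
discards `S_i`, moves the dimension vectors of all other indecomposables by `s_i`, and yields a
torsion free class for the orientation in which `i` is a source (`isTorsionFreeIn_reflDown`).
Conversely, a class without `S_i` for that orientation reflects to one containing `S_i`
(`isTorsionFreeIn_reflUp`).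

Hence the class of a sortable word is built from the zero class by `Classifies.skip` and
`Classifies.take`. `Classifies` also records that each inversion is the dimension vector of exactly
one indecomposable up to isomorphism, which gives finiteness. `exists_sortableWord` goes back from a
finite class to a word, since each reflection lowers the number of dimension vectors. Injectivity
holds because the class determines the inversion set, and the inversion set determines the element
(`inv_injective`).

To keep a single quiver while orientations change, all representations are placed on the symmetrized
quiver; `Adm c` says which arrows act as zero. Reflection is a relation `ReflData` rather than a
functor. Decompositions into indecomposables are only needed to exist; their uniqueness plays no
role. -/

set_option linter.unusedSectionVars false

namespace QuiverTF
section Weyl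
variable {V : Type v} [Fintype V] [DecidableEq V] [Quiver.{w} V] [IsAcyclic V]

/-! ### The symmetrized form and simple reflections. -/

theorem eulerForm_apply (β γ : V → ℤ) : eulerForm V β γ =
    ∑ i, β i * γ i - ∑ i, ∑ j, (Nat.card (i ⟶ j) : ℤ) * (β i * γ j) := rfl

theorem symForm_apply (β γ : V → ℤ) :
    symForm V β γ = eulerForm V β γ + eulerForm V γ β := rfl

theorem symForm_stdVec_apply (i : V) (x : V → ℤ) : symForm V (stdVec i) x =
    2 * x i - ∑ j, ((Nat.card (i ⟶ j) : ℤ) + Nat.card (j ⟶ i)) * x j := by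
  simp only [symForm_apply, eulerForm_apply, stdVec,
    Pi.single_apply, ite_mul, one_mul, zero_mul, mul_ite, mul_one, mul_zero,
    Finset.sum_ite_eq', Finset.mem_univ, if_true, add_mul, Finset.sum_add_distrib]
  simp only [Finset.sum_ite_irrel, Finset.sum_const_zero, Finset.sum_ite_eq', Finset.mem_univ,
    if_true]
  ring

theorem symForm_comm (x y : V → ℤ) : symForm V x y = symForm V y x := by
  rw [symForm_apply, symForm_apply, add_comm]

theorem symForm_stdVec_nonpos {i j : V} (h : i ≠ j) :
    symForm V (stdVec i) (stdVec j) ≤ 0 := by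
  rw [symForm_stdVec_apply]
  simp only [stdVec, Pi.single_apply, if_neg h, mul_ite, mul_one, mul_zero, zero_sub,
    Finset.sum_ite_eq', Finset.mem_univ, if_true]
  linarith [Int.natCast_nonneg (Nat.card (i ⟶ j)), Int.natCast_nonneg (Nat.card (j ⟶ i))]

theorem simpleReflection_apply (i : V) (x : V → ℤ) :
    simpleReflection i x = x - symForm V (stdVec i) x • stdVec i :=
  Module.reflection_apply _ _

theorem simpleReflection_apply_of_ne {i j : V} (h : j ≠ i) (x : V → ℤ) :
    simpleReflection i x j = x j := by
  simp [simpleReflection_apply, stdVec, h]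

theorem simpleReflection_stdVec_self (i : V) : simpleReflection i (stdVec i) = -stdVec i :=
  Module.reflection_apply_self _

@[simp]
theorem simpleReflection_simpleReflection (i : V) (x : V → ℤ) :
    simpleReflection i (simpleReflection i x) = x :=
  Module.involutive_reflection _ x

theorem symForm_simpleReflection (i : V) (x y : V → ℤ) :
    symForm V (simpleReflection i x) (simpleReflection i y) = symForm V x y := by
  simp only [simpleReflection_apply, map_sub, map_smul, LinearMap.sub_apply, LinearMap.smul_apply,
    smul_eq_mul, symForm_stdVec_self, symForm_comm x (stdVec i)]
  ring

/-- A reflection is a transvection along `e_i` with functional `-(e_i, ·)`, so its determinant is `1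
- 2`. The resulting sign character shows that multiplication by a generator always changes the
length. -/
theorem det_simpleReflection (i : V) :
    LinearMap.det (simpleReflection i : (V → ℤ) →ₗ[ℤ] (V → ℤ)) = -1 := by
  have h : (simpleReflection i : (V → ℤ) →ₗ[ℤ] (V → ℤ)) =
      LinearMap.transvection (-(symForm V (stdVec i))) (stdVec i) := by
    refine LinearMap.ext fun x => ?_
    simp [simpleReflection_apply, LinearMap.transvection.apply, sub_eq_add_neg]
  rw [h, LinearMap.transvection.det, LinearMap.neg_apply, symForm_stdVec_self]
  norm_num

theorem stdVec_nonneg (i : V) : 0 ≤ stdVec i := by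
  rw [stdVec]
  exact Pi.single_nonneg.2 zero_le_one

theorem stdVec_ne_zero (i : V) : stdVec i ≠ 0 := by
  simp [stdVec]

/-! ### Words and length -/

@[simp]
theorem wordProd_nil : wordProd ([] : List V) = 1 := rfl

@[simp]
theorem wordProd_cons (i : V) (ω : List V) : wordProd (i :: ω) = simpleGen i * wordProd ω := by
  simp [wordProd]

@[simp]
theorem wordProd_append (ω ω' : List V) :
    wordProd (ω ++ ω') = wordProd ω * wordProd ω' := by
  simp [wordProd]

@[simp]
theorem simpleGen_mul_self (i : V) : simpleGen i * simpleGen i = 1 := by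
  ext x : 2
  exact simpleReflection_simpleReflection i x

@[simp]
theorem simpleGen_mul_cancel_left (i : V) (x : weylGroup V) :
    simpleGen i * (simpleGen i * x) = x := by
  rw [← mul_assoc, simpleGen_mul_self, one_mul]

@[simp]
theorem simpleGen_mul_cancel_right (i : V) (x : weylGroup V) :
    x * simpleGen i * simpleGen i = x := by
  rw [mul_assoc, simpleGen_mul_self, mul_one]

@[simp]
theorem inv_simpleGen (i : V) : (simpleGen i)⁻¹ = simpleGen i :=
  inv_eq_of_mul_eq_one_left (simpleGen_mul_self i)

/-- The action of the Weyl group on the root lattice. -/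
noncomputable def act (x : weylGroup V) (β : V → ℤ) : V → ℤ :=
  (x : (V → ℤ) ≃ₗ[ℤ] (V → ℤ)) β

@[simp]
theorem act_one (β : V → ℤ) : act 1 β = β := rfl

theorem act_mul (x y : weylGroup V) (β : V → ℤ) : act (x * y) β = act x (act y β) := rfl

theorem act_simpleGen (i : V) (β : V → ℤ) : act (simpleGen i) β = simpleReflection i β := rfl

theorem act_neg (x : weylGroup V) (β : V → ℤ) : act x (-β) = -act x β := map_neg _ _

theorem act_injective (x : weylGroup V) : Function.Injective (act x) :=
  (x : (V → ℤ) ≃ₗ[ℤ] (V → ℤ)).injective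

theorem act_zero (x : weylGroup V) : act x 0 = 0 := map_zero _

theorem act_add (x : weylGroup V) (β γ : V → ℤ) : act x (β + γ) = act x β + act x γ :=
  map_add _ _ _

theorem act_smul (x : weylGroup V) (a : ℤ) (β : V → ℤ) : act x (a • β) = a • act x β :=
  map_smul _ _ _

theorem exists_wordProd_eq (x : weylGroup V) : ∃ ω, wordProd ω = x := by
  obtain ⟨x, hx⟩ := x
  induction hx using Subgroup.closure_induction with
  | mem x h =>
    obtain ⟨i, rfl⟩ := h
    exact ⟨[i], by simp; rfl⟩
  | one => exact ⟨[], rfl⟩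
  | mul x y _ _ hx hy =>
    obtain ⟨ω, hω⟩ := hx
    obtain ⟨ω', hω'⟩ := hy
    exact ⟨ω ++ ω', by rw [wordProd_append, hω, hω']; rfl⟩
  | inv x _ hx =>
    obtain ⟨ω, hω⟩ := hx
    refine ⟨ω.reverse, ?_⟩
    have h : ∀ ω : List V, wordProd ω.reverse = (wordProd ω)⁻¹ := by
      intro ω
      induction ω with
      | nil => simp
      | cons i ω ih => simp [ih]
    rw [h, hω]
    rfl

theorem symForm_act (x : weylGroup V) (β γ : V → ℤ) :
    symForm V (act x β) (act x γ) = symForm V β γ := by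
  obtain ⟨ω, rfl⟩ := exists_wordProd_eq x
  induction ω with
  | nil => simp
  | cons i ω ih =>
    rw [wordProd_cons, act_mul, act_mul, act_simpleGen, act_simpleGen,
      symForm_simpleReflection, ih]

/-- The length of an element of the Weyl group. -/
noncomputable def len (x : weylGroup V) : ℕ :=
  sInf (List.length '' {ω : List V | wordProd ω = x})

theorem len_wordProd_le (ω : List V) : len (wordProd ω) ≤ ω.length :=
  Nat.sInf_le ⟨ω, rfl, rfl⟩

theorem exists_length_eq_len (x : weylGroup V) :
    ∃ ω, wordProd ω = x ∧ ω.length = len x := by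
  obtain ⟨ω, hω⟩ := exists_wordProd_eq x
  exact Nat.sInf_mem (s := List.length '' {ω : List V | wordProd ω = x}) ⟨_, ω, hω, rfl⟩

theorem isReduced_iff (ω : List V) : IsReduced ω ↔ len (wordProd ω) = ω.length := by
  constructor
  · intro h
    obtain ⟨ω', h1, h2⟩ := exists_length_eq_len (wordProd ω)
    exact le_antisymm (len_wordProd_le ω) (h2 ▸ h ω' h1)
  · intro h ω' h'
    rw [← h, ← h']
    exact len_wordProd_le ω'

theorem exists_isReduced (x : weylGroup V) : ∃ ω, IsReduced ω ∧ wordProd ω = x := by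
  obtain ⟨ω, h1, h2⟩ := exists_length_eq_len x
  exact ⟨ω, (isReduced_iff ω).2 (by rw [h1, h2]), h1⟩

theorem len_mul_le (x y : weylGroup V) : len (x * y) ≤ len x + len y := by
  obtain ⟨ω, rfl, h⟩ := exists_length_eq_len x
  obtain ⟨ω', rfl, h'⟩ := exists_length_eq_len y
  rw [← h, ← h', ← wordProd_append, ← List.length_append]
  exact len_wordProd_le _

theorem len_simpleGen_le (i : V) : len (simpleGen i) ≤ 1 := by
  simpa using len_wordProd_le [i]

@[simp]
theorem len_one : len (1 : weylGroup V) = 0 := by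
  simpa using len_wordProd_le ([] : List V)

theorem isReduced_nil : IsReduced ([] : List V) := by
  rw [isReduced_iff]; simp

theorem det_wordProd (ω : List V) :
    LinearMap.det ((wordProd ω : (V → ℤ) ≃ₗ[ℤ] (V → ℤ)) : (V → ℤ) →ₗ[ℤ] (V → ℤ)) =
      (-1) ^ ω.length := by
  induction ω with
  | nil => simp
  | cons i ω ih =>
    have : (((wordProd (i :: ω) : weylGroup V) : (V → ℤ) ≃ₗ[ℤ] (V → ℤ)) :
        (V → ℤ) →ₗ[ℤ] (V → ℤ)) = (simpleReflection i : (V → ℤ) →ₗ[ℤ] (V → ℤ)) *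
          ((wordProd ω : (V → ℤ) ≃ₗ[ℤ] (V → ℤ)) : (V → ℤ) →ₗ[ℤ] (V → ℤ)) := by
      rw [wordProd_cons]; rfl
    rw [this, map_mul, ih, det_simpleReflection, List.length_cons, pow_succ]
    ring

theorem len_parity (x : weylGroup V) :
    LinearMap.det ((x : (V → ℤ) ≃ₗ[ℤ] (V → ℤ)) : (V → ℤ) →ₗ[ℤ] (V → ℤ)) = (-1) ^ len x := by
  obtain ⟨ω, rfl, h⟩ := exists_length_eq_len x
  rw [← h, det_wordProd]

theorem len_mul_simpleGen_ne (x : weylGroup V) (i : V) : len (x * simpleGen i) ≠ len x := by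
  intro h
  have h1 := len_parity (x * simpleGen i)
  have h2 : (((x * simpleGen i : weylGroup V) : (V → ℤ) ≃ₗ[ℤ] (V → ℤ)) :
      (V → ℤ) →ₗ[ℤ] (V → ℤ)) = ((x : (V → ℤ) ≃ₗ[ℤ] (V → ℤ)) : (V → ℤ) →ₗ[ℤ] (V → ℤ)) *
        (simpleReflection i : (V → ℤ) →ₗ[ℤ] (V → ℤ)) := rfl
  rw [h2, map_mul, det_simpleReflection, len_parity, h] at h1
  have h3 : ((-1 : ℤ)) ^ len x ≠ 0 := pow_ne_zero _ (by norm_num)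
  apply h3
  linarith

theorem len_mul_simpleGen (x : weylGroup V) (i : V) :
    len (x * simpleGen i) = len x + 1 ∨ len x = len (x * simpleGen i) + 1 := by
  have h1 := len_mul_simpleGen_ne x i
  have h2 := len_mul_le x (simpleGen i)
  have h3 := len_mul_le (x * simpleGen i) (simpleGen i)
  have h4 := len_simpleGen_le i
  rw [simpleGen_mul_cancel_right] at h3
  omega

theorem len_inv (x : weylGroup V) : len x⁻¹ = len x := by
  have h : ∀ ω : List V, wordProd ω.reverse = (wordProd ω)⁻¹ := by
    intro ω
    induction ω with
    | nil => simp
    | cons i ω ih => simp [ih]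
  have key : ∀ x : weylGroup V, len x⁻¹ ≤ len x := by
    intro x
    obtain ⟨ω, rfl, h2⟩ := exists_length_eq_len x
    rw [← h2, ← h, ← List.length_reverse]
    exact len_wordProd_le _
  refine le_antisymm (key x) ?_
  simpa using key x⁻¹

theorem len_simpleGen_mul (x : weylGroup V) (i : V) :
    len (simpleGen i * x) = len x + 1 ∨ len x = len (simpleGen i * x) + 1 := by
  have h := len_mul_simpleGen x⁻¹ i
  have h1 : x⁻¹ * simpleGen i = (simpleGen i * x)⁻¹ := by simp
  rwa [h1, len_inv, len_inv] at h

theorem IsReduced.tail {i : V} {ω : List V} (h : IsReduced (i :: ω)) : IsReduced ω := by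
  intro ω' h'
  have := h (i :: ω') (by simp [h'])
  simpa using this

end Weyl
end QuiverTF

namespace QuiverTF
section Weyl
variable {V : Type v} [Fintype V] [DecidableEq V] [Quiver.{w} V] [IsAcyclic V]

/-! ### Positivity of roots -/

theorem mul_simpleGen_eq_of_act {x : weylGroup V} {i j : V} (h : act x (stdVec i) = stdVec j) :
    x * simpleGen i = simpleGen j * x := by
  apply Subtype.ext
  apply LinearEquiv.ext
  intro β
  change act x (simpleReflection i β) = simpleReflection j (act x β)
  rw [simpleReflection_apply, simpleReflection_apply, ← h, symForm_act, sub_eq_add_neg,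
    ← neg_smul, act_add, act_smul, neg_smul, sub_eq_add_neg]

theorem not_isReduced_cons_cons (i : V) (ω : List V) : ¬ IsReduced (i :: i :: ω) := by
  intro h
  have := h ω (by simp)
  simp at this

/-- The rank two case of the positivity of roots. -/
theorem exists_act_stdVec_eq_of_rank_two {s t : V} (hst : s ≠ t) (ω : List V)
    (hω : ∀ r ∈ ω, r = s ∨ r = t) (hred : IsReduced (ω ++ [s])) :
    ∃ x y : V, (x = s ∧ y = t ∨ x = t ∧ y = s) ∧ (∃ ω', ω ++ [s] = x :: ω') ∧
      ∃ a b : ℤ, 0 ≤ a ∧ 0 ≤ b ∧ act (wordProd ω) (stdVec s) = a • stdVec x + b • stdVec y := by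
  induction ω with
  | nil => exact ⟨s, t, Or.inl ⟨rfl, rfl⟩, ⟨[], rfl⟩, 1, 0, by simp, le_rfl, by simp⟩
  | cons z ω ih =>
    have hred' := hred
    rw [List.cons_append] at hred'
    obtain ⟨x, y, hxy, ⟨ω', h'⟩, a, b, ha, hb, hab⟩ :=
      ih (fun r hr => hω r (List.mem_cons_of_mem _ hr)) hred'.tail
    have hne : x ≠ y := by
      rcases hxy with ⟨rfl, rfl⟩ | ⟨rfl, rfl⟩
      · exact hst
      · exact hst.symm
    have hz : z = y := by
      have h1 : z ≠ x := by
        rintro rfl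
        rw [h'] at hred'
        exact not_isReduced_cons_cons _ _ hred'
      have h2 := hω z (by simp)
      rcases hxy with ⟨rfl, rfl⟩ | ⟨rfl, rfl⟩
      · exact h2.resolve_left h1
      · exact h2.resolve_right h1
    subst hz
    have hm : symForm V (stdVec z) (stdVec x) ≤ 0 := symForm_stdVec_nonpos hne.symm
    -- Invariance of the form: the root has square length 2, and the equation is divided by 2.
    have hnorm : a * a + b * b + symForm V (stdVec z) (stdVec x) * (a * b) = 1 := by
      have h1 := symForm_act (wordProd ω) (stdVec s) (stdVec s)
      rw [hab, symForm_stdVec_self] at h1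
      simp only [map_add, map_smul, LinearMap.add_apply, LinearMap.smul_apply, smul_eq_mul,
        symForm_stdVec_self, symForm_comm (stdVec x) (stdVec z)] at h1
      linarith
    -- If `a = 0`, the root is `e_z` itself, and then the letter `z` in front cancels against the
    -- final `s`, contradicting reducedness.
    have ha0 : a ≠ 0 := by
      rintro rfl
      have hb1 : b = 1 := by nlinarith
      rw [hb1, zero_smul, one_smul, zero_add] at hab
      have h1 := mul_simpleGen_eq_of_act hab
      have h2 := hred' ω (by
        rw [wordProd_cons, wordProd_append, wordProd_cons, wordProd_nil, mul_one, h1]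
        simp)
      simp at h2
    refine ⟨z, x, by tauto, ⟨ω ++ [s], rfl⟩,
      -(symForm V (stdVec z) (stdVec x)) * a - b, a, ?_, ha, ?_⟩
    -- Write `m = (e_z, e_x) ≤ 0`. A negative coefficient means `b > -m * a ≥ 0`, so `a * a` and `b
    -- * (b + m * a)` are both at least 1, whereas their sum is 1 by `hnorm`.
    · by_contra hneg
      have h0 : 1 ≤ a := by omega
      have h1 : 0 < b := by nlinarith
      nlinarith
    · rw [wordProd_cons, act_mul, hab, act_simpleGen, map_add, map_smul, map_smul,
        simpleReflection_stdVec_self, simpleReflection_apply]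
      module

/-- Reduction to rank two. Let `t` be the last letter of a reduced word of `x`, and write `x = y *
ν` with lengths adding, `ν` a word in `s, t` and `y` as short as possible. Neither `s` nor `t`
shortens `y` from the right, so `y e_s` and `y e_t` are nonnegative by induction, while `ν e_s` is a
nonnegative combination of `e_s` and `e_t`. -/
theorem act_stdVec_nonneg_of_len (n : ℕ) : ∀ (x : weylGroup V) (s : V), len x = n →
    len (x * simpleGen s) = len x + 1 → 0 ≤ act x (stdVec s) := by
  induction n using Nat.strong_induction_on with
  | _ n ih =>
  intro x s hn hs
  obtain ⟨ω, hω, hlen⟩ := exists_length_eq_len x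
  rcases List.eq_nil_or_concat ω with rfl | ⟨ω', t, rfl⟩
  · rw [← hω]
    exact stdVec_nonneg s
  have ht : len x = len (x * simpleGen t) + 1 := by
    rcases len_mul_simpleGen x t with h | h
    · have h1 : x * simpleGen t = wordProd ω' := by
        rw [← hω]; simp
      have h2 := len_wordProd_le ω'
      rw [← h1] at h2
      simp at hlen
      omega
    · exact h
  have hst : s ≠ t := by
    rintro rfl
    omega
  let A : Set ℕ := {l | ∃ (y : weylGroup V) (ν : List V), len y = l ∧ (∀ r ∈ ν, r = s ∨ r = t) ∧
    x = y * wordProd ν ∧ len x = len y + ν.length}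
  have hA : (len (x * simpleGen t)) ∈ A :=
    ⟨x * simpleGen t, [t], rfl, by simp, by simp, by simpa using ht⟩
  obtain ⟨y, ν, hy, hν, hx, hl⟩ := Nat.sInf_mem ⟨_, hA⟩
  have hmin : ∀ l ∈ A, len y ≤ l := fun l hl => hy ▸ Nat.sInf_le hl
  have hyx : len y < n := by
    have := hmin _ hA
    omega
  -- If `r` shortened `y`, it could be moved into `ν`, contradicting the minimality of `y`.
  have hup : ∀ r, (r = s ∨ r = t) → len (y * simpleGen r) = len y + 1 := by
    intro r hr
    refine (len_mul_simpleGen y r).resolve_right fun h => ?_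
    have h1 : x = (y * simpleGen r) * wordProd (r :: ν) := by
      rw [wordProd_cons, ← mul_assoc, simpleGen_mul_cancel_right, hx]
    have h2 := len_mul_le (y * simpleGen r) (wordProd (r :: ν))
    have h3 := len_wordProd_le (r :: ν)
    rw [← h1] at h2
    rw [List.length_cons] at h3
    have h4 := hmin (len (y * simpleGen r)) ⟨y * simpleGen r, r :: ν, rfl, by
      intro q hq
      rcases List.mem_cons.1 hq with rfl | hq
      · exact hr
      · exact hν q hq, h1, by rw [List.length_cons]; omega⟩
    omega
  have hred : IsReduced (ν ++ [s]) := by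
    intro ν' hν'
    have h1 : x * simpleGen s = y * wordProd ν' := by
      rw [hν', hx]; simp [mul_assoc]
    have h2 := len_mul_le y (wordProd ν')
    have h3 := len_wordProd_le ν'
    rw [← h1] at h2
    simp
    omega
  obtain ⟨p, q, hpq, -, a, b, ha, hb, hab⟩ := exists_act_stdVec_eq_of_rank_two hst ν hν hred
  have hp : 0 ≤ act y (stdVec p) :=
    ih _ hyx y p rfl (hup p (by tauto))
  have hq : 0 ≤ act y (stdVec q) :=
    ih _ hyx y q rfl (hup q (by tauto))
  rw [hx, act_mul, hab, act_add, act_smul, act_smul]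
  exact add_nonneg (smul_nonneg ha hp) (smul_nonneg hb hq)

/-- Every real root is positive or negative. -/
theorem act_stdVec_nonneg_or_nonpos (x : weylGroup V) (i : V) :
    0 ≤ act x (stdVec i) ∨ act x (stdVec i) ≤ 0 := by
  rcases len_mul_simpleGen x i with h | h
  · exact Or.inl (act_stdVec_nonneg_of_len _ x i rfl h)
  · right
    have := act_stdVec_nonneg_of_len _ (x * simpleGen i) i rfl
      (by rw [simpleGen_mul_cancel_right, h])
    rw [act_mul, act_simpleGen, simpleReflection_stdVec_self, act_neg] at this
    exact neg_nonneg.1 this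

/-- The real roots. -/
def IsRoot (β : V → ℤ) : Prop := ∃ (x : weylGroup V) (i : V), β = act x (stdVec i)

theorem IsRoot.stdVec (i : V) : IsRoot (stdVec i) := ⟨1, i, rfl⟩

theorem IsRoot.act {β : V → ℤ} (h : IsRoot β) (x : weylGroup V) : IsRoot (act x β) := by
  obtain ⟨y, i, rfl⟩ := h
  exact ⟨x * y, i, rfl⟩

theorem IsRoot.simpleReflection {β : V → ℤ} (h : IsRoot β) (i : V) :
    IsRoot (simpleReflection i β) := h.act (simpleGen i)

theorem IsRoot.ne_zero {β : V → ℤ} (h : IsRoot β) : β ≠ 0 := by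
  obtain ⟨y, i, rfl⟩ := h
  intro h
  exact stdVec_ne_zero i (act_injective y (by rw [h, act_zero]))

theorem IsRoot.nonneg_or_nonpos {β : V → ℤ} (h : IsRoot β) : 0 ≤ β ∨ β ≤ 0 := by
  obtain ⟨y, i, rfl⟩ := h
  exact act_stdVec_nonneg_or_nonpos y i

theorem IsRoot.symForm_self {β : V → ℤ} (h : IsRoot β) : symForm V β β = 2 := by
  obtain ⟨y, i, rfl⟩ := h
  rw [symForm_act, symForm_stdVec_self]

/-- A simple reflection permutes the positive roots other than its simple root. -/
theorem IsRoot.simpleReflection_nonneg {β : V → ℤ} (h : IsRoot β) (h0 : 0 ≤ β) {i : V}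
    (hi : β ≠ QuiverTF.stdVec i) : 0 ≤ QuiverTF.simpleReflection i β := by
  rcases (h.simpleReflection i).nonneg_or_nonpos with h1 | h1
  · exact h1
  · exfalso
    -- Only the `i`-th coordinate changes under `s_i`. If the image is nonpositive, all other
    -- coordinates of `β` vanish, and square length 2 then forces `β = e_i`.
    have h2 : β = β i • QuiverTF.stdVec i := by
      funext j
      by_cases hj : j = i
      · subst hj
        simp [QuiverTF.stdVec]
      · have := h1 j
        rw [simpleReflection_apply_of_ne hj] at this
        have := le_antisymm this (h0 j)
        simp only [Pi.zero_apply] at this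
        simp [QuiverTF.stdVec, hj, this]
    have h3 := h.symForm_self
    rw [h2] at h3
    simp only [map_smul, LinearMap.smul_apply, symForm_stdVec_self, smul_eq_mul] at h3
    have h4 : 0 ≤ β i := h0 i
    have h5 : β i = 1 := by nlinarith
    rw [h5, one_smul] at h2
    exact hi h2

/-! ### Inversion sets -/

/-- The positive roots that become negative under the inverse of `x`. -/
def posInv (x : weylGroup V) : Set (V → ℤ) := {β | IsRoot β ∧ 0 ≤ β ∧ act x⁻¹ β ≤ 0}

@[simp]
theorem wordInv_nil : wordInv ([] : List V) = ∅ := by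
  ext β
  simp [wordInv]

@[simp]
theorem wordInv_cons (i : V) (ω : List V) :
    wordInv (i :: ω) = insert (stdVec i) (simpleReflection i '' wordInv ω) := by
  ext β
  constructor
  · rintro ⟨ω₁, ω₂, j, h, rfl⟩
    cases ω₁ with
    | nil =>
      simp only [List.nil_append, List.cons.injEq] at h
      left
      rw [h.1]
      rfl
    | cons l ω₁ =>
      simp only [List.cons_append, List.cons.injEq] at h
      right
      refine ⟨_, ⟨ω₁, ω₂, j, h.2, rfl⟩, ?_⟩
      rw [wordProd_cons, h.1]
      rfl
  · rintro (rfl | ⟨_, ⟨ω₁, ω₂, j, rfl, rfl⟩, rfl⟩)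
    · exact ⟨[], ω, i, rfl, rfl⟩
    · exact ⟨i :: ω₁, ω₂, j, rfl, by rw [wordProd_cons]; rfl⟩

theorem finite_wordInv (ω : List V) : (wordInv ω).Finite := by
  induction ω with
  | nil => simp
  | cons i ω ih => rw [wordInv_cons]; exact (ih.image _).insert _

/-- A positive root other than `e_i` stays positive under `s_i`, so its change of sign is due to a
later letter. The word need not be reduced. -/
theorem posInv_subset_wordInv (ω : List V) : posInv (wordProd ω) ⊆ wordInv ω := by
  induction ω with
  | nil =>
    rintro β ⟨h, h0, h1⟩
    simp only [wordProd_nil, inv_one, act_one] at h1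
    exact absurd (le_antisymm h1 h0) h.ne_zero
  | cons i ω ih =>
    rintro β ⟨h, h0, h1⟩
    rw [wordInv_cons]
    by_cases hi : β = stdVec i
    · exact Or.inl hi
    · right
      refine ⟨simpleReflection i β, ih ⟨h.simpleReflection i, h.simpleReflection_nonneg h0 hi, ?_⟩,
        by simp⟩
      rw [wordProd_cons, mul_inv_rev, inv_simpleGen, act_mul] at h1
      exact h1

theorem stdVec_mem_posInv_or (x : weylGroup V) (i : V) :
    stdVec i ∈ posInv x ∨ 0 ≤ act x⁻¹ (stdVec i) := by
  rcases act_stdVec_nonneg_or_nonpos x⁻¹ i with h | h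
  · exact Or.inr h
  · exact Or.inl ⟨IsRoot.stdVec i, stdVec_nonneg i, h⟩

theorem posInv_simpleGen_mul {x : weylGroup V} {i : V} (h : stdVec i ∉ posInv x) :
    posInv (simpleGen i * x) = insert (stdVec i) (simpleReflection i '' posInv x) := by
  ext β
  constructor
  · rintro ⟨h1, h2, h3⟩
    rw [mul_inv_rev, inv_simpleGen, act_mul] at h3
    by_cases hi : β = stdVec i
    · exact Or.inl hi
    · exact Or.inr ⟨simpleReflection i β, ⟨h1.simpleReflection i,
        h1.simpleReflection_nonneg h2 hi, h3⟩, by simp⟩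
  · rintro (rfl | ⟨β, ⟨h1, h2, h3⟩, rfl⟩)
    · refine ⟨IsRoot.stdVec i, stdVec_nonneg i, ?_⟩
      rw [mul_inv_rev, inv_simpleGen, act_mul, act_simpleGen, simpleReflection_stdVec_self,
        act_neg]
      exact neg_nonpos.2 ((stdVec_mem_posInv_or x i).resolve_left h)
    · refine ⟨h1.simpleReflection i, h1.simpleReflection_nonneg h2 ?_, ?_⟩
      · rintro rfl
        exact h ⟨h1, h2, h3⟩
      · rw [mul_inv_rev, inv_simpleGen, act_mul, act_simpleGen,
          simpleReflection_simpleReflection]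
        exact h3

theorem stdVec_notMem_posInv_simpleGen_mul {x : weylGroup V} {i : V} (h : stdVec i ∈ posInv x) :
    stdVec i ∉ posInv (simpleGen i * x) := by
  rintro ⟨-, -, h3⟩
  rw [mul_inv_rev, inv_simpleGen, act_mul, act_simpleGen, simpleReflection_stdVec_self,
    act_neg] at h3
  exact ((IsRoot.stdVec i).act x⁻¹).ne_zero (le_antisymm h.2.2 (neg_nonpos.1 h3))

/-- The exchange condition: if `e_i = ω₁ e_j`, then `s_i ω₁ = ω₁ s_j`, so multiplying by `s_i`
deletes the letter `j` that follows `ω₁`. -/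
theorem len_simpleGen_mul_lt_of_mem_wordInv {ω : List V} {i : V} (h : stdVec i ∈ wordInv ω) :
    len (simpleGen i * wordProd ω) < ω.length := by
  obtain ⟨ω₁, ω₂, j, rfl, h⟩ := h
  have h1 : wordProd ω₁ * simpleGen j = simpleGen i * wordProd ω₁ :=
    mul_simpleGen_eq_of_act h.symm
  have h2 : simpleGen i * wordProd (ω₁ ++ j :: ω₂) = wordProd (ω₁ ++ ω₂) := by
    rw [wordProd_append, wordProd_cons, ← mul_assoc, ← h1, wordProd_append, mul_assoc,
      simpleGen_mul_cancel_left]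
  rw [h2]
  refine (len_wordProd_le _).trans_lt ?_
  simp

theorem isReduced_cons_iff (i : V) (ω : List V) :
    IsReduced (i :: ω) ↔ IsReduced ω ∧ stdVec i ∉ wordInv ω := by
  constructor
  · intro h
    refine ⟨h.tail, fun h1 => ?_⟩
    have h2 := len_simpleGen_mul_lt_of_mem_wordInv h1
    rw [isReduced_iff, wordProd_cons, List.length_cons] at h
    omega
  · rintro ⟨h1, h2⟩
    rw [isReduced_iff] at h1 ⊢
    rw [wordProd_cons, List.length_cons, ← h1]
    refine (len_simpleGen_mul _ _).resolve_right fun h3 => ?_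
    have h4 : stdVec i ∈ posInv (simpleGen i * wordProd ω) := by
      by_contra h5
      apply h2
      apply posInv_subset_wordInv
      have := posInv_simpleGen_mul h5
      rw [simpleGen_mul_cancel_left] at this
      rw [this]
      exact Or.inl rfl
    -- The exchange condition, applied to a shortest word of `s_i ω`, shows that `ω` is shorter than
    -- `s_i ω`, the opposite of `h3`.
    obtain ⟨ν, hν, hl⟩ := exists_length_eq_len (simpleGen i * wordProd ω)
    rw [← hν] at h4
    have h5 := len_simpleGen_mul_lt_of_mem_wordInv (posInv_subset_wordInv _ h4)
    rw [hν, simpleGen_mul_cancel_left] at h5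
    omega

theorem IsReduced.wordInv_eq {ω : List V} (h : IsReduced ω) :
    wordInv ω = posInv (wordProd ω) := by
  induction ω with
  | nil =>
    have h1 := posInv_subset_wordInv ([] : List V)
    rw [wordInv_nil] at h1 ⊢
    exact (Set.subset_empty_iff.1 h1).symm
  | cons i ω ih =>
    obtain ⟨h1, h2⟩ := (isReduced_cons_iff i ω).1 h
    rw [ih h1] at h2
    rw [wordProd_cons, posInv_simpleGen_mul h2, wordInv_cons, ih h1]

theorem inv_eq_posInv (x : weylGroup V) : inv x = posInv x := by
  ext β
  constructor
  · rintro ⟨ω, h, rfl, hβ⟩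
    rwa [← h.wordInv_eq]
  · intro hβ
    obtain ⟨ω, h, rfl⟩ := exists_isReduced x
    exact ⟨ω, h, rfl, by rwa [h.wordInv_eq]⟩

theorem IsReduced.inv_wordProd {ω : List V} (h : IsReduced ω) :
    inv (wordProd ω) = wordInv ω := by
  rw [inv_eq_posInv, h.wordInv_eq]

theorem stdVec_notMem_image_posInv (x : weylGroup V) (i : V) :
    stdVec i ∉ simpleReflection i '' posInv x := by
  rintro ⟨β, h, h1⟩
  have h2 : β = -stdVec i := by
    rw [← simpleReflection_stdVec_self, ← h1, simpleReflection_simpleReflection]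
  have h3 := h.2.1
  rw [h2] at h3
  exact stdVec_ne_zero i (le_antisymm (neg_nonneg.1 h3) (stdVec_nonneg i))

/-- The first letter `i` of a reduced word of `x` gives `e_i` in the common inversion set, so `s_i`
can be stripped from both elements; removing `e_i` and applying `s_i` leaves equal, smaller
inversion sets. -/
theorem posInv_injective : Function.Injective (posInv : weylGroup V → Set (V → ℤ)) := by
  intro x y hxy
  obtain ⟨ω, h, rfl⟩ := exists_isReduced x
  induction ω generalizing y with
  | nil =>
    obtain ⟨ν, h', rfl⟩ := exists_isReduced y
    rw [← h.wordInv_eq, ← h'.wordInv_eq, wordInv_nil] at hxy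
    cases ν with
    | nil => rfl
    | cons j ν =>
      exfalso
      rw [wordInv_cons] at hxy
      exact (Set.insert_nonempty _ _).ne_empty hxy.symm
  | cons i ω ih =>
    obtain ⟨h1, h2⟩ := (isReduced_cons_iff i ω).1 h
    rw [h1.wordInv_eq] at h2
    have h3 : stdVec i ∈ posInv y := by
      rw [← hxy, ← h.wordInv_eq, wordInv_cons]
      exact Or.inl rfl
    have h4 := posInv_simpleGen_mul (stdVec_notMem_posInv_simpleGen_mul h3)
    rw [simpleGen_mul_cancel_left] at h4
    rw [wordProd_cons, posInv_simpleGen_mul h2, h4] at hxy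
    have h5 := congrArg (· \ {stdVec i}) hxy
    simp only [Set.insert_sdiff_self_of_notMem (stdVec_notMem_image_posInv _ i)] at h5
    replace h5 := Set.image_injective.2 (simpleReflection i).injective h5
    rw [wordProd_cons, ih h1 h5, simpleGen_mul_cancel_left]

theorem inv_injective : Function.Injective (inv : weylGroup V → Set (V → ℤ)) := by
  intro x y h
  rw [inv_eq_posInv, inv_eq_posInv] at h
  exact posInv_injective h

end Weyl
end QuiverTF

namespace QuiverTF

/-! ### Sortable words -/

/-- Recursive description of sortable words: at each stage the first letter `i` of the Coxeter
word is either discarded for good, or used and moved to the end. -/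
inductive SortableWord {V : Type v} : List V → List V → Prop
  | nil : SortableWord [] []
  | skip {i : V} {c ω : List V} : SortableWord c ω → SortableWord (i :: c) ω
  | take {i : V} {c ω : List V} : SortableWord (c ++ [i]) ω → SortableWord (i :: c) (i :: ω)

section Sortable

variable {V : Type v} [DecidableEq V]

/-- The word `c_{J_1} ⋯ c_{J_k}`. -/
def sortWord (c : List V) (J : List (Finset V)) : List V :=
  J.flatMap fun A => c.filter (· ∈ A)

theorem sortWord_nil (c : List V) : sortWord c [] = [] := rfl

theorem sortWord_cons (c : List V) (A : Finset V) (J : List (Finset V)) :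
    sortWord c (A :: J) = c.filter (· ∈ A) ++ sortWord c J := rfl

theorem sortWord_congr {c c' : List V} {J : List (Finset V)}
    (h : ∀ A ∈ J, c.filter (· ∈ A) = c'.filter (· ∈ A)) : sortWord c J = sortWord c' J := by
  induction J with
  | nil => rfl
  | cons A J ih =>
    rw [sortWord_cons, sortWord_cons, h A (by simp), ih fun B hB => h B (by simp [hB])]

theorem sortWord_map_erase {c : List V} {i : V} (hi : i ∉ c) (J : List (Finset V)) :
    sortWord c (J.map (·.erase i)) = sortWord c J := by
  induction J with
  | nil => rfl
  | cons A J ih =>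
    rw [List.map_cons, sortWord_cons, sortWord_cons, ih]
    congr 1
    apply List.filter_congr
    intro x hx
    have : x ≠ i := by rintro rfl; exact hi hx
    simp [this]

/-- Passing from `i :: c` to `c ++ [i]` once the first letter has been used. -/
theorem exists_rotate (c : List V) (i : V) (hi : i ∉ c) (J : List (Finset V)) :
    ∀ A : Finset V, (A :: J).Pairwise (fun A B => B ⊆ A) → i ∈ A →
      ∃ J' : List (Finset V), J'.Pairwise (fun A B => B ⊆ A) ∧ (∀ B ∈ J', B ⊆ A) ∧
        sortWord (i :: c) (A :: J) = i :: sortWord (c ++ [i]) J' := by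
  induction J with
  | nil =>
    intro A _ hA
    refine ⟨[A.erase i], by simp, by simp [Finset.erase_subset], ?_⟩
    have h1 : c.filter (· ∈ A.erase i) = c.filter (· ∈ A) := by
      apply List.filter_congr
      intro x hx
      have : x ≠ i := by rintro rfl; exact hi hx
      simp [this]
    simp only [sortWord_cons, sortWord_nil, List.append_nil, List.filter_append, h1]
    simp [hA]
  | cons B J ih =>
    intro A hJ hA
    obtain ⟨h1, h2⟩ := List.pairwise_cons.1 hJ
    by_cases hB : i ∈ B
    · obtain ⟨J', hJ', hs, he⟩ := ih B h2 hB
      have hBA := h1 B (by simp)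
      refine ⟨A :: J', List.pairwise_cons.2 ⟨fun C hC => (hs C hC).trans hBA, hJ'⟩, ?_, ?_⟩
      · intro C hC
        rcases List.mem_cons.1 hC with rfl | hC
        · exact subset_rfl
        · exact (hs C hC).trans hBA
      · rw [sortWord_cons, he, sortWord_cons]
        simp [hA]
    -- Here `A` is the last set containing `i`. Its letter `i` is the one already used, and by
    -- nestedness no later block contains another.
    · refine ⟨A.erase i :: B :: J, List.pairwise_cons.2 ⟨fun C hC => ?_, h2⟩, ?_, ?_⟩
      · intro x hx
        rw [Finset.mem_erase]
        refine ⟨?_, h1 C hC hx⟩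
        rintro rfl
        rcases List.mem_cons.1 hC with rfl | hC
        · exact hB hx
        · exact hB ((List.pairwise_cons.1 h2).1 C hC hx)
      · intro C hC
        rcases List.mem_cons.1 hC with rfl | hC
        · exact Finset.erase_subset _ _
        · exact h1 C hC
      · have h3 : sortWord (i :: c) (B :: J) = sortWord (c ++ [i]) (B :: J) := by
          apply sortWord_congr
          intro C hC
          have : i ∉ C := by
            intro hx
            rcases List.mem_cons.1 hC with rfl | hC
            · exact hB hx
            · exact hB ((List.pairwise_cons.1 h2).1 C hC hx)
          simp [this]
        have h4 : c.filter (· ∈ A.erase i) = c.filter (· ∈ A) := by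
          apply List.filter_congr
          intro x hx
          have : x ≠ i := by rintro rfl; exact hi hx
          simp [this]
        rw [sortWord_cons, h3, sortWord_cons (c ++ [i]) (A.erase i), List.filter_append, h4]
        simp [hA]

/-- The converse recutting: a leading `i` followed by blocks `c_A i` is recut into blocks `i c_A`,
and the letter left over is absorbed by the first set not containing `i`, or by a new block `{i}`.
The bound `D` keeps the new chain nested when a set is put in front of it. -/
theorem exists_unrotate (c : List V) (i : V) (hi : i ∉ c) (J : List (Finset V)) :
    ∀ D : Finset V, J.Pairwise (fun A B => B ⊆ A) → i ∈ D → (∀ B ∈ J, B ⊆ D) →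
      ∃ J' : List (Finset V), J'.Pairwise (fun A B => B ⊆ A) ∧ (∀ B ∈ J', B ⊆ D) ∧
        sortWord (i :: c) J' = i :: sortWord (c ++ [i]) J := by
  induction J with
  | nil =>
    intro D _ hD _
    refine ⟨[{i}], by simp, by simpa using hD, ?_⟩
    have : c.filter (· ∈ ({i} : Finset V)) = [] := by
      rw [List.filter_eq_nil_iff]
      rintro x hx
      simp only [Finset.mem_singleton, decide_eq_true_eq]
      rintro rfl
      exact hi hx
    simp only [sortWord_cons, sortWord_nil, List.append_nil]
    rw [List.filter_cons_of_pos (by simp), this]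
  | cons A J ih =>
    intro D hJ hD hs
    obtain ⟨h1, h2⟩ := List.pairwise_cons.1 hJ
    by_cases hA : i ∈ A
    · obtain ⟨J', hJ', hs', he⟩ := ih A h2 hA h1
      have hAD := hs A (by simp)
      refine ⟨A :: J', List.pairwise_cons.2 ⟨hs', hJ'⟩, ?_, ?_⟩
      · intro C hC
        rcases List.mem_cons.1 hC with rfl | hC
        · exact hAD
        · exact (hs' C hC).trans hAD
      · rw [sortWord_cons, he, sortWord_cons]
        simp [hA]
    · refine ⟨insert i A :: J, List.pairwise_cons.2 ⟨fun C hC => ?_, h2⟩, ?_, ?_⟩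
      · exact (h1 C hC).trans (Finset.subset_insert _ _)
      · intro C hC
        rcases List.mem_cons.1 hC with rfl | hC
        · exact Finset.insert_subset hD (hs A (by simp))
        · exact hs C (by simp [hC])
      · have h3 : sortWord (i :: c) J = sortWord (c ++ [i]) J := by
          apply sortWord_congr
          intro C hC
          have : i ∉ C := fun hx => hA (h1 C hC hx)
          simp [this]
        have h4 : c.filter (· ∈ insert i A) = c.filter (· ∈ A) := by
          apply List.filter_congr
          intro x hx
          have : x ≠ i := by rintro rfl; exact hi hx
          simp [this]
        rw [sortWord_cons, h3, sortWord_cons, List.filter_append,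
          List.filter_cons_of_pos (by simp), h4]
        simp [hA]

theorem sortableWord_nil (c : List V) : SortableWord c [] := by
  induction c with
  | nil => exact .nil
  | cons i c ih => exact .skip ih

theorem sortableWord_of_forall_nil {c : List V} {J : List (Finset V)}
    (h : sortWord c J = []) : SortableWord c (sortWord c J) := by
  rw [h]
  exact sortableWord_nil c

/-- A double induction: `take` shortens the word but only rotates `c`, whereas `skip` keeps the word
and shortens `c`. -/
theorem sortableWord_sortWord (n : ℕ) : ∀ (c : List V) (J : List (Finset V)),
    (sortWord c J).length = n → c.Nodup → J.Pairwise (fun A B => B ⊆ A) →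
      SortableWord c (sortWord c J) := by
  induction n with
  | zero =>
    intro c J h _ _
    exact sortableWord_of_forall_nil (List.length_eq_zero_iff.1 h)
  | succ n ihn =>
    intro c
    induction c with
    | nil =>
      intro J h
      have : sortWord ([] : List V) J = [] := by simp [sortWord]
      simp [this] at h
    | cons i c ih =>
      intro J hl hc hJ
      obtain ⟨hi, hc'⟩ := List.nodup_cons.1 hc
      cases J with
      | nil => simp [sortWord_nil] at hl
      | cons A J =>
        by_cases hA : i ∈ A
        · obtain ⟨J', hJ', -, he⟩ := exists_rotate c i hi J A hJ hA
          rw [he] at hl ⊢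
          refine .take (ihn _ _ (by simpa using hl) ?_ hJ')
          exact (List.perm_append_singleton i c).symm.nodup hc
        · have h1 : sortWord (i :: c) (A :: J) = sortWord c (A :: J) := by
            apply sortWord_congr
            intro C hC
            have : i ∉ C := by
              intro hx
              rcases List.mem_cons.1 hC with rfl | hC
              · exact hA hx
              · exact hA ((List.pairwise_cons.1 hJ).1 C hC hx)
            simp [this]
          rw [h1] at hl ⊢
          exact .skip (ih _ hl hc' hJ)

theorem SortableWord.exists_sortWord {c ω : List V} (h : SortableWord c ω) (hc : c.Nodup) :
    ∃ J : List (Finset V), J.Pairwise (fun A B => B ⊆ A) ∧ sortWord c J = ω := by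
  induction h with
  | nil => exact ⟨[], by simp, rfl⟩
  | @skip i c ω _ ih =>
    obtain ⟨hi, hc'⟩ := List.nodup_cons.1 hc
    obtain ⟨J, hJ, he⟩ := ih hc'
    -- The sets may contain `i`, which is invisible to `c` but would produce letters for `i :: c`.
    refine ⟨J.map (·.erase i), ?_, ?_⟩
    · rw [List.pairwise_map]
      exact hJ.imp fun h => Finset.erase_subset_erase _ h
    · rw [← he, ← sortWord_map_erase hi]
      apply sortWord_congr
      intro A hA
      obtain ⟨B, -, rfl⟩ := List.mem_map.1 hA
      simp
  | @take i c ω _ ih =>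
    obtain ⟨hi, hc'⟩ := List.nodup_cons.1 hc
    obtain ⟨J, hJ, he⟩ := ih ((List.perm_append_singleton i c).symm.nodup hc)
    obtain ⟨J', hJ', -, he'⟩ := exists_unrotate c i hi J
      (insert i (J.foldr (· ∪ ·) ∅)) hJ (Finset.mem_insert_self _ _) (by
        intro B hB
        refine Finset.Subset.trans ?_ (Finset.subset_insert _ _)
        clear he hJ
        induction J with
        | nil => simp at hB
        | cons A J ih =>
          rcases List.mem_cons.1 hB with rfl | hB
          · exact Finset.subset_union_left
          · exact (ih hB).trans Finset.subset_union_right)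
    exact ⟨J', hJ', by rw [he', he]⟩

theorem isSortable_iff [Fintype V] [Quiver.{w} V] [IsAcyclic V] {c : List V} (hc : c.Nodup)
    (x : weylGroup V) :
    IsSortable c x ↔ ∃ ω, SortableWord c ω ∧ IsReduced ω ∧ wordProd ω = x := by
  constructor
  · rintro ⟨J, hJ, h1, h2⟩
    exact ⟨_, sortableWord_sortWord _ c J rfl hc hJ, h1, h2⟩
  · rintro ⟨ω, h, h1, h2⟩
    obtain ⟨J, hJ, rfl⟩ := h.exists_sortWord hc
    exact ⟨J, hJ, h1, h2⟩

end Sortable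
end QuiverTF

namespace QuiverRep

variable {k : Type u} [Field k] {V : Type v} [Quiver.{w} V]

/-! ### Morphisms, subrepresentations and decompositions -/

namespace Hom

/-- The identity morphism. -/
def id (X : QuiverRep k V) : Hom X X := ⟨fun _ => LinearMap.id, fun _ _ => rfl⟩

/-- Composition of morphisms. -/
def comp {X Y Z : QuiverRep k V} (g : Hom Y Z) (f : Hom X Y) : Hom X Z :=
  ⟨fun i => (g.app i).comp (f.app i), fun a x => by simp [f.comm, g.comm]⟩

theorem exists_inverse {X Y : QuiverRep k V} (f : Hom X Y)
    (hf : ∀ i, Function.Bijective (f.app i)) :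
    ∃ g : Hom Y X, (∀ i x, g.app i (f.app i x) = x) ∧ ∀ i y, f.app i (g.app i y) = y := by
  let e := fun i => LinearEquiv.ofBijective (f.app i) (hf i)
  have h1 : ∀ i x, (e i).symm (f.app i x) = x := fun i x => (e i).symm_apply_apply x
  have h2 : ∀ i y, f.app i ((e i).symm y) = y := fun i y => (e i).apply_symm_apply y
  refine ⟨⟨fun i => (e i).symm, fun {i j} a y => (hf j).1 ?_⟩, h1, h2⟩
  simp only [LinearEquiv.coe_coe]
  rw [h2, f.comm, h2]

end Hom

theorem Isomorphic.refl (X : QuiverRep k V) : Isomorphic X X :=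
  ⟨Hom.id X, fun _ => Function.bijective_id⟩

theorem Isomorphic.symm {X Y : QuiverRep k V} (h : Isomorphic X Y) : Isomorphic Y X := by
  obtain ⟨f, hf⟩ := h
  obtain ⟨g, h1, h2⟩ := f.exists_inverse hf
  exact ⟨g, fun i => ⟨Function.LeftInverse.injective (g := f.app i) (h2 i),
    Function.RightInverse.surjective (g := f.app i) (h1 i)⟩⟩

theorem Isomorphic.trans {X Y Z : QuiverRep k V} (h : Isomorphic X Y) (h' : Isomorphic Y Z) :
    Isomorphic X Z := by
  obtain ⟨f, hf⟩ := h
  obtain ⟨g, hg⟩ := h'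
  exact ⟨g.comp f, fun i => (hg i).comp (hf i)⟩

theorem Isomorphic.dimVec_eq {X Y : QuiverRep k V} (h : Isomorphic X Y) :
    X.dimVec = Y.dimVec := by
  obtain ⟨f, hf⟩ := h
  funext i
  simp only [dimVec]
  rw [(LinearEquiv.ofBijective (f.app i) (hf i)).finrank_eq]

theorem Isomorphic.isZero {X Y : QuiverRep k V} (h : Isomorphic X Y) (hX : X.IsZero) :
    Y.IsZero := by
  obtain ⟨f, hf⟩ := h
  intro i
  have := hX i
  exact (hf i).2.subsingleton

theorem Isomorphic.indecomposable {X Y : QuiverRep k V} (h : Isomorphic X Y)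
    (hX : X.Indecomposable) : Y.Indecomposable :=
  ⟨fun hY => hX.1 (h.symm.isZero hY), fun A B hAB => hX.2 A B (h.trans hAB)⟩

theorem dimVec_nonneg (X : QuiverRep k V) : 0 ≤ X.dimVec := fun _ => Int.natCast_nonneg _

theorem dimVec_apply_eq_zero_iff {X : QuiverRep k V} {i : V} :
    X.dimVec i = 0 ↔ Subsingleton (X.space i) := by
  simp only [dimVec, Int.natCast_eq_zero]
  exact Module.finrank_zero_iff

theorem isZero_iff_dimVec {X : QuiverRep k V} : X.IsZero ↔ X.dimVec = 0 := by
  rw [funext_iff]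
  exact forall_congr' fun i => dimVec_apply_eq_zero_iff.symm

theorem dimVec_prod (X Y : QuiverRep k V) : (X.prod Y).dimVec = X.dimVec + Y.dimVec := by
  funext i
  simp only [dimVec, Pi.add_apply]
  exact_mod_cast Module.finrank_prod

/-- The first projection of a direct sum. -/
def fstHom (X Y : QuiverRep k V) : Hom (X.prod Y) X :=
  ⟨fun i => LinearMap.fst k (X.space i) (Y.space i), fun _ _ => rfl⟩

/-- The second projection of a direct sum. -/
def sndHom (X Y : QuiverRep k V) : Hom (X.prod Y) Y :=
  ⟨fun i => LinearMap.snd k (X.space i) (Y.space i), fun _ _ => rfl⟩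

/-- The first inclusion of a direct sum. -/
def inlHom (X Y : QuiverRep k V) : Hom X (X.prod Y) :=
  ⟨fun i => LinearMap.inl k (X.space i) (Y.space i), fun a x => by
    change (X.map a x, (0 : Y.space _)) = (X.map a x, Y.map a 0)
    rw [map_zero]⟩

/-- The projections of a finite direct sum. -/
def projHom {n : ℕ} (Y : Fin n → QuiverRep k V) (m : Fin n) : Hom (directSum Y) (Y m) :=
  ⟨fun _ => LinearMap.proj m, fun _ _ => rfl⟩

/-- The subrepresentation given by a stable family of subspaces. -/
def subrep (X : QuiverRep k V) (p : ∀ i, Submodule k (X.space i))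
    (hp : ∀ {i j : V} (a : i ⟶ j), ∀ x ∈ p i, X.map a x ∈ p j) : QuiverRep k V where
  space i := p i
  map a := (X.map a).restrict (hp a)

section Subrep

variable {X : QuiverRep k V} {p q : ∀ i, Submodule k (X.space i)}
  (hp : ∀ {i j : V} (a : i ⟶ j), ∀ x ∈ p i, X.map a x ∈ p j)
  (hq : ∀ {i j : V} (a : i ⟶ j), ∀ x ∈ q i, X.map a x ∈ q j)

/-- The inclusion of a subrepresentation. -/
def subrepHom : Hom (X.subrep p hp) X := ⟨fun i => (p i).subtype, fun _ _ => rfl⟩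

theorem subrepHom_injective (i : V) : Function.Injective ((subrepHom hp).app i) :=
  Subtype.val_injective

theorem isomorphic_prod_of_isCompl (h : ∀ i, IsCompl (p i) (q i)) :
    Isomorphic X ((X.subrep p hp).prod (X.subrep q hq)) := by
  refine Isomorphic.symm ⟨⟨fun i => ((p i).prodEquivOfIsCompl (q i) (h i) :
    (p i × q i) →ₗ[k] X.space i), ?_⟩, fun i => ((p i).prodEquivOfIsCompl (q i) (h i)).bijective⟩
  rintro i j a ⟨⟨x, hx⟩, ⟨y, hy⟩⟩
  change X.map a x + X.map a y = X.map a (x + y)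
  rw [map_add]

theorem isZero_subrep_iff : (X.subrep p hp).IsZero ↔ ∀ i, p i = ⊥ := by
  refine forall_congr' fun i => ?_
  exact Submodule.subsingleton_iff_eq_bot

/-- An indecomposable representation has no proper complemented subrepresentations. -/
theorem Indecomposable.eq_bot_or_eq_bot (hX : X.Indecomposable)
    (hp : ∀ {i j : V} (a : i ⟶ j), ∀ x ∈ p i, X.map a x ∈ p j)
    (hq : ∀ {i j : V} (a : i ⟶ j), ∀ x ∈ q i, X.map a x ∈ q j)
    (h : ∀ i, IsCompl (p i) (q i)) : (∀ i, p i = ⊥) ∨ ∀ i, q i = ⊥ := by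
  have := hX.2 _ _ (isomorphic_prod_of_isCompl hp hq h)
  rwa [isZero_subrep_iff, isZero_subrep_iff] at this

end Subrep

/-- The kernel of a morphism. -/
def ker {X Y : QuiverRep k V} (f : Hom X Y) : QuiverRep k V :=
  X.subrep (fun i => LinearMap.ker (f.app i)) fun a x hx => by
    rw [LinearMap.mem_ker] at hx ⊢
    rw [f.comm, hx, map_zero]

/-- The image of a morphism. -/
def range {X Y : QuiverRep k V} (f : Hom X Y) : QuiverRep k V :=
  Y.subrep (fun i => LinearMap.range (f.app i)) fun a x hx => by
    obtain ⟨y, rfl⟩ := hx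
    exact ⟨X.map a y, f.comm a y⟩

/-- The inclusion of the kernel. -/
def kerHom {X Y : QuiverRep k V} (f : Hom X Y) : Hom (ker f) X :=
  ⟨fun i => (LinearMap.ker (f.app i)).subtype, fun _ _ => rfl⟩

/-- The inclusion of the image. -/
def rangeHom {X Y : QuiverRep k V} (f : Hom X Y) : Hom (range f) Y :=
  ⟨fun i => (LinearMap.range (f.app i)).subtype, fun _ _ => rfl⟩

/-- The corestriction of a morphism to its image. -/
def toRange {X Y : QuiverRep k V} (f : Hom X Y) : Hom X (range f) :=
  ⟨fun i => (f.app i).rangeRestrict, fun a x => Subtype.ext (f.comm a x)⟩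

/-- Extend a family defined away from `i` by a value at `i`. -/
theorem exists_family {V : Type*} {P : V → Type*} (i : V) (g : P i)
    (r : ∀ j, j ≠ i → P j) : ∃ f : ∀ j, P j, f i = g ∧ ∀ j h, f j = r j h := by
  classical
  exact ⟨fun j => if h : j = i then h ▸ g else r j h, by simp, fun j h => by simp [h]⟩

section Decomposition

variable [Fintype V]

/-- The total dimension of a representation. -/
noncomputable def totalDim (X : QuiverRep k V) : ℤ := ∑ i, X.dimVec i

theorem totalDim_pos {X : QuiverRep k V} (h : ¬ X.IsZero) : 0 < X.totalDim := by
  have h0 : ∀ i ∈ Finset.univ, 0 ≤ X.dimVec i := fun i _ => X.dimVec_nonneg i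
  refine lt_of_le_of_ne (Finset.sum_nonneg h0) fun h1 => h ?_
  rw [isZero_iff_dimVec]
  funext i
  exact (Finset.sum_eq_zero_iff_of_nonneg h0).1 h1.symm i (Finset.mem_univ i)

theorem totalDim_prod (X Y : QuiverRep k V) :
    (X.prod Y).totalDim = X.totalDim + Y.totalDim := by
  simp [totalDim, dimVec_prod, Finset.sum_add_distrib]

/-- Induction on the total dimension. With jointly bijective projections over an arbitrary finite
index type, a splitting in two corresponds to a disjoint union of index types. -/
theorem exists_decomposition (n : ℕ) : ∀ X : QuiverRep k V, X.totalDim ≤ n →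
    ∃ (ι : Type) (_ : Fintype ι) (Y : ι → QuiverRep k V) (π : ∀ a, Hom X (Y a)),
      (∀ a, (Y a).Indecomposable) ∧
      ∀ i, Function.Bijective (fun (x : X.space i) a => (π a).app i x) := by
  induction n with
  | zero =>
    intro X hX
    have h : X.IsZero := by
      by_contra h
      have := totalDim_pos h
      simp at hX
      omega
    refine ⟨Empty, inferInstance, Empty.elim, fun a => a.elim, fun a => a.elim, fun i => ?_⟩
    have := h i
    exact ⟨Function.injective_of_subsingleton _, fun y => ⟨0, funext fun a => a.elim⟩⟩
  | succ n ih =>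
    intro X hX
    by_cases hz : X.IsZero
    · apply ih
      have : X.totalDim = 0 := by
        rw [totalDim, isZero_iff_dimVec.1 hz]
        simp
      omega
    by_cases hi : X.Indecomposable
    · refine ⟨Unit, inferInstance, fun _ => X, fun _ => Hom.id X, fun _ => hi, fun i => ⟨?_, ?_⟩⟩
      · intro x y h
        exact congrFun h ()
      · intro y
        exact ⟨y (), rfl⟩
    · simp only [Indecomposable, not_and, not_forall, not_or] at hi
      obtain ⟨A, B, hAB, hA, hB⟩ := hi hz
      have h1 := totalDim_pos hA
      have h2 := totalDim_pos hB
      have h3 : X.totalDim = A.totalDim + B.totalDim := by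
        rw [← totalDim_prod, totalDim, hAB.dimVec_eq, totalDim]
      push_cast at hX
      obtain ⟨ι, _, Y, π, hY, hπ⟩ := ih A (by omega)
      obtain ⟨κ, _, Z, ρ, hZ, hρ⟩ := ih B (by omega)
      obtain ⟨f, hf⟩ := hAB
      refine ⟨ι ⊕ κ, inferInstance, Sum.elim Y Z, fun s => match s with
        | .inl a => ((π a).comp (fstHom A B)).comp f
        | .inr b => ((ρ b).comp (sndHom A B)).comp f, ?_, fun i => ⟨?_, ?_⟩⟩
      · rintro (a | b)
        · exact hY a
        · exact hZ b
      · intro x y h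
        apply (hf i).1
        apply Prod.ext
        · exact (hπ i).1 (funext fun a => congrFun h (.inl a))
        · exact (hρ i).1 (funext fun b => congrFun h (.inr b))
      · intro y
        obtain ⟨a, ha⟩ := (hπ i).2 fun s => y (.inl s)
        obtain ⟨b, hb⟩ := (hρ i).2 fun s => y (.inr s)
        obtain ⟨x, hx⟩ := (hf i).2 (a, b)
        refine ⟨x, funext ?_⟩
        have hx1 : ((fstHom A B).app i) (f.app i x) = a := by rw [hx]; rfl
        have hx2 : ((sndHom A B).app i) (f.app i x) = b := by rw [hx]; rfl
        rintro (s | s)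
        · exact (congrArg ((π s).app i) hx1).trans (congrFun ha s)
        · exact (congrArg ((ρ s).app i) hx2).trans (congrFun hb s)

/-- Every representation is a finite direct sum of indecomposables. -/
theorem exists_isomorphic_directSum (X : QuiverRep k V) :
    ∃ (n : ℕ) (Y : Fin n → QuiverRep k V), (∀ m, (Y m).Indecomposable) ∧
      (∀ m, ∃ f : Hom (Y m) X, ∀ i, Function.Injective (f.app i)) ∧
      Isomorphic X (directSum Y) := by
  classical
  obtain ⟨ι, _, Y, π, hY, hπ⟩ := exists_decomposition X.totalDim.toNat X (by simp)
  let e := (Fintype.equivFin ι).symm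
  have hiso : Isomorphic X (directSum fun m => Y (e m)) := by
    refine ⟨⟨fun i => LinearMap.pi fun m => (π (e m)).app i, fun a x =>
      funext fun m => (π (e m)).comm a x⟩, fun i => ⟨?_, ?_⟩⟩
    · intro x y h
      refine (hπ i).1 (funext fun a => ?_)
      obtain ⟨m, rfl⟩ := e.surjective a
      exact congrFun h m
    · intro y
      obtain ⟨x, hx⟩ := (hπ i).2 (Equiv.piCongrLeft (fun a => (Y a).space i) e y)
      refine ⟨x, funext fun m => ?_⟩
      exact (congrFun hx (e m)).trans 
        (Equiv.piCongrLeft_apply_apply (fun a => (Y a).space i) e y m)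
  refine ⟨_, _, fun m => hY (e m), fun m => ?_, hiso⟩
  obtain ⟨g, hg⟩ := hiso.symm
  let ι' : Hom (Y (e m)) (directSum fun m => Y (e m)) :=
    ⟨fun i => LinearMap.single k (fun m => (Y (e m)).space i) m, fun {i j} a x => by
      funext l
      by_cases h : l = m
      · subst h
        change (Pi.single l ((Y (e l)).map a x) : ∀ m, (Y (e m)).space j) l =
          (Y (e l)).map a ((Pi.single l x : ∀ m, (Y (e m)).space i) l)
        rw [Pi.single_eq_same, Pi.single_eq_same]
      · change (Pi.single m ((Y (e m)).map a x) : ∀ m, (Y (e m)).space j) l =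
          (Y (e l)).map a ((Pi.single m x : ∀ m, (Y (e m)).space i) l)
        rw [Pi.single_eq_of_ne h, Pi.single_eq_of_ne h, map_zero]⟩
  refine ⟨g.comp ι', fun i => (hg i).1.comp ?_⟩
  exact Pi.single_injective (M := fun m => (Y (e m)).space i) m

end Decomposition

end QuiverRep

namespace QuiverRep

variable {k : Type u} [Field k] {V : Type v} [Quiver.{w} V]

/-! ### Torsion free classes inside a class of representations -/

/-- Subclasses of a class `A` of representations that are torsion free relative to `A`. -/
structure IsTorsionFreeIn (A T : Set (QuiverRep k V)) : Prop where
  subset : T ⊆ A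
  zero_mem : ∀ X : QuiverRep k V, X.IsZero → X ∈ T
  sub_mem : ∀ {X Y : QuiverRep k V} (f : Hom X Y),
    (∀ i, Function.Injective (f.app i)) → Y ∈ T → X ∈ T
  ext_mem : ∀ {X Y Z : QuiverRep k V} (f : Hom X Y) (g : Hom Y Z),
    (∀ i, Function.Injective (f.app i)) → (∀ i, Function.Exact (f.app i) (g.app i)) →
    (∀ i, Function.Surjective (g.app i)) → Y ∈ A → X ∈ T → Z ∈ T → Y ∈ T

namespace IsTorsionFreeIn

variable {A T : Set (QuiverRep k V)}

theorem iso_mem (hT : IsTorsionFreeIn A T) {X Y : QuiverRep k V} (h : Isomorphic X Y)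
    (hY : Y ∈ T) : X ∈ T := by
  obtain ⟨f, hf⟩ := h
  exact hT.sub_mem f (fun i => (hf i).1) hY

/-- Replacing `Z` by the image of `g`, which lies in `T` as a subobject, makes the sequence short
exact. This is why left exactness of reflection suffices later. -/
theorem mem_of_leftExact (hT : IsTorsionFreeIn A T) {X Y Z : QuiverRep k V}
    (f : Hom X Y) (g : Hom Y Z)
    (hf : ∀ i, Function.Injective (f.app i)) (hfg : ∀ i, Function.Exact (f.app i) (g.app i))
    (hY : Y ∈ A) (hX : X ∈ T) (hZ : Z ∈ T) : Y ∈ T := by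
  refine hT.ext_mem f (toRange g) hf (fun i y => ?_)
    (fun i => LinearMap.surjective_rangeRestrict _) hY hX
    (hT.sub_mem (rangeHom g) (fun i => Subtype.val_injective) hZ)
  rw [← hfg i y]
  exact Subtype.ext_iff

theorem mem_of_ker_mem (hT : IsTorsionFreeIn A T) {Y Z : QuiverRep k V} (g : Hom Y Z)
    (hY : Y ∈ A) (hX : ker g ∈ T)
    (hZ : Z ∈ T) : Y ∈ T := by
  refine hT.mem_of_leftExact (kerHom g) g (fun i => Subtype.val_injective) (fun i y => ?_) hY hX hZ
  constructor
  · intro h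
    exact ⟨⟨y, h⟩, rfl⟩
  · rintro ⟨x, rfl⟩
    exact x.2

/-- The kernel of the first map is jointly embedded by the remaining ones, so the maps can be peeled
off one at a time as extensions. This replaces embedding `X` into a finite direct sum. -/
theorem mem_of_jointly_injective (hT : IsTorsionFreeIn A T) {n : ℕ} :
    ∀ {X : QuiverRep k V} {Y : Fin n → QuiverRep k V}
    (π : ∀ m, Hom X (Y m)), (∀ i (x : X.space i), (∀ m, (π m).app i x = 0) → x = 0) →
    X ∈ A → (∀ m, Y m ∈ T) → (∀ {X Y : QuiverRep k V} (f : Hom X Y),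
    (∀ i, Function.Injective (f.app i)) → Y ∈ A → X ∈ A) → X ∈ T := by
  induction n with
  | zero =>
    intro X Y π h _ _ _
    exact hT.zero_mem X fun i => ⟨fun x y => by
      rw [h i x (fun m => m.elim0), h i y (fun m => m.elim0)]⟩
  | succ n ih =>
    intro X Y π h hX hY hA
    refine hT.mem_of_ker_mem (π 0) hX ?_ (hY 0)
    refine ih (fun m => (π m.succ).comp (kerHom (π 0))) ?_
      (hA (kerHom (π 0)) (fun i => Subtype.val_injective) hX) (fun m => hY m.succ) hA
    intro i x hx
    refine Subtype.ext (h i x.1 fun m => ?_)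
    refine Fin.cases ?_ (fun m => ?_) m
    · exact x.2
    · exact hx m

end IsTorsionFreeIn

/-! ### Oriented representations of a symmetric quiver -/

/-- Representations supported on the vertices of `c` in which an arrow acts as zero unless it
goes from a later to an earlier entry of `c`. -/
structure Adm (c : List V) (X : QuiverRep k V) : Prop where
  support : ∀ j ∉ c, Subsingleton (X.space j)
  oriented : c.Pairwise fun i j => ∀ a : i ⟶ j, X.map a = 0

theorem Adm.sub {c : List V} {X Y : QuiverRep k V} (f : Hom X Y)
    (hf : ∀ i, Function.Injective (f.app i)) (hY : Adm c Y) : Adm c X := by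
  refine ⟨fun j hj => ?_, hY.oriented.imp fun h a => ?_⟩
  · have := hY.support j hj
    exact (hf j).subsingleton
  · ext x
    apply hf
    rw [f.comm, h a]
    simp

theorem Adm.of_isZero {c : List V} {X : QuiverRep k V} (h : X.IsZero) : Adm c X := by
  refine ⟨fun j _ => h j, List.pairwise_of_forall fun i j a => ?_⟩
  have := h i
  exact LinearMap.ext fun x => by rw [Subsingleton.elim x 0]; simp

/-- No arrow leaving `i` acts. -/
def IsSink (i : V) (X : QuiverRep k V) : Prop := ∀ (b : V) (a : i ⟶ b), X.map a = 0

/-- No arrow entering `i` acts. -/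
def IsSource (i : V) (X : QuiverRep k V) : Prop := ∀ (b : V) (a : b ⟶ i), X.map a = 0

section NoLoops

variable [∀ i : V, IsEmpty (i ⟶ i)]

theorem Adm.isSink {i : V} {c : List V} {X : QuiverRep k V} (h : Adm (i :: c) X) :
    IsSink i X := by
  intro b a
  by_cases hb : b ∈ c
  · exact (List.pairwise_cons.1 h.oriented).1 b hb a
  · by_cases hi : b = i
    · subst hi
      exact isEmptyElim a
    · have := h.support b (by simp [hi, hb])
      exact LinearMap.ext fun x => Subsingleton.elim _ _

theorem Adm.isSource {i : V} {c : List V} {X : QuiverRep k V} (h : Adm (c ++ [i]) X) :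
    IsSource i X := by
  intro b a
  by_cases hb : b ∈ c
  · exact (List.pairwise_append.1 h.oriented).2.2 b hb i (by simp) a
  · by_cases hi : b = i
    · subst hi
      exact isEmptyElim a
    · have := h.support b (by simp [hi, hb])
      exact LinearMap.ext fun x => by rw [Subsingleton.elim x 0]; simp

theorem Adm.tail {i : V} {c : List V} {X : QuiverRep k V} (h : Adm (i :: c) X)
    (hi : Subsingleton (X.space i)) : Adm c X := by
  refine ⟨fun j hj => ?_, (List.pairwise_cons.1 h.oriented).2⟩
  by_cases hji : j = i
  · exact hji ▸ hi
  · exact h.support j (by simp [hji, hj])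

theorem Adm.cons {i : V} {c : List V} {X : QuiverRep k V} (h : Adm c X)
    (hi : Subsingleton (X.space i)) : Adm (i :: c) X := by
  refine ⟨fun j hj => h.support j fun h' => hj (List.mem_cons_of_mem _ h'),
    List.pairwise_cons.2 ⟨fun b _ a => ?_, h.oriented⟩⟩
  exact LinearMap.ext fun x => by rw [Subsingleton.elim x 0]; simp

/-! ### Reflections -/

/-- The arrows ending in `i`. -/
abbrev Nbr (i : V) : Type (max v w) := Σ b : V, (b ⟶ i)

theorem Nbr.ne {i : V} (p : Nbr i) : p.1 ≠ i := by
  obtain ⟨b, a⟩ := p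
  intro (h : b = i)
  subst h
  exact isEmptyElim a

theorem ne_of_hom {i b : V} (a : b ⟶ i) : b ≠ i := Nbr.ne ⟨b, a⟩

theorem ne_of_hom' {i b : V} (a : i ⟶ b) : b ≠ i := (ne_of_hom a).symm

/-- Extend linear maps at the vertices other than a source `i` by a linear map at `i`. -/
theorem exists_hom_of_isSource {X Y : QuiverRep k V} {i : V} (hX : IsSource i X)
    (hY : IsSource i Y) (r : ∀ j, j ≠ i → (X.space j →ₗ[k] Y.space j))
    (hr : ∀ {a b : V} (ha : a ≠ i) (hb : b ≠ i) (h : a ⟶ b) (x : X.space a),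
      r b hb (X.map h x) = Y.map h (r a ha x))
    (g : X.space i →ₗ[k] Y.space i)
    (hg : ∀ (b : V) (hb : b ≠ i) (h : i ⟶ b) (x : X.space i),
      r b hb (X.map h x) = Y.map h (g x)) :
    ∃ f : Hom X Y, f.app i = g ∧ ∀ j hj, f.app j = r j hj := by
  obtain ⟨f, hf, hf'⟩ := exists_family (P := fun j => X.space j →ₗ[k] Y.space j) i g r
  refine ⟨⟨f, fun {a b} h x => ?_⟩, hf, hf'⟩
  by_cases hb : b = i
  · subst hb
    rw [hX a h, hY a h]
    simp
  · by_cases ha : a = i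
    · subst ha
      rw [hf, hf' b hb, hg]
    · rw [hf' a ha, hf' b hb, hr]

/-- Extend linear maps at the vertices other than a sink `i` by a linear map at `i`. -/
theorem exists_hom_of_isSink {X Y : QuiverRep k V} {i : V} (hX : IsSink i X)
    (hY : IsSink i Y) (r : ∀ j, j ≠ i → (X.space j →ₗ[k] Y.space j))
    (hr : ∀ {a b : V} (ha : a ≠ i) (hb : b ≠ i) (h : a ⟶ b) (x : X.space a),
      r b hb (X.map h x) = Y.map h (r a ha x))
    (g : X.space i →ₗ[k] Y.space i)
    (hg : ∀ (b : V) (hb : b ≠ i) (h : b ⟶ i) (x : X.space b),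
      g (X.map h x) = Y.map h (r b hb x)) :
    ∃ f : Hom X Y, f.app i = g ∧ ∀ j hj, f.app j = r j hj := by
  obtain ⟨f, hf, hf'⟩ := exists_family (P := fun j => X.space j →ₗ[k] Y.space j) i g r
  refine ⟨⟨f, fun {a b} h x => ?_⟩, hf, hf'⟩
  by_cases ha : a = i
  · subst ha
    rw [hX b h, hY b h]
    simp
  · by_cases hb : b = i
    · subst hb
      rw [hf, hf' a ha, hg]
    · rw [hf' a ha, hf' b hb, hr]

/-- Replace the space of a representation at one vertex. -/
theorem exists_replace (X : QuiverRep k V) (i : V) (U : Type*) [AddCommGroup U] [Module k U]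
    [Module.Finite k U] (α : ∀ b, (b ⟶ i) → (X.space b →ₗ[k] U))
    (β : ∀ b, (i ⟶ b) → (U →ₗ[k] X.space b)) :
    ∃ (Y : QuiverRep k V) (e : ∀ j, j ≠ i → (X.space j ≃ₗ[k] Y.space j))
      (ε : U ≃ₗ[k] Y.space i),
      (∀ {a b : V} (ha : a ≠ i) (hb : b ≠ i) (h : a ⟶ b) (x : X.space a),
        e b hb (X.map h x) = Y.map h (e a ha x)) ∧
      (∀ (b : V) (hb : b ≠ i) (h : b ⟶ i) (x : X.space b),
        Y.map h (e b hb x) = ε (α b h x)) ∧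
      ∀ (b : V) (hb : b ≠ i) (h : i ⟶ b) (x : U), Y.map h (ε x) = e b hb (β b h x) := by
  classical
  -- Coordinate spaces are used because `U` may live in another universe than the spaces of `X`.
  let n : V → ℕ := fun j => if j = i then Module.finrank k U else Module.finrank k (X.space j)
  let S : V → Type u := fun j => Fin (n j) → k
  let e : ∀ j, j ≠ i → (X.space j ≃ₗ[k] S j) := fun j hj =>
    LinearEquiv.ofFinrankEq _ _ (by simp [S, n, hj])
  let ε : U ≃ₗ[k] S i := LinearEquiv.ofFinrankEq _ _ (by simp [S, n])
  have h1 : ∀ a, a ≠ i → ∃ M : ∀ b, (a ⟶ b) → (S a →ₗ[k] S b), ∀ ha : a ≠ i,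
      (∀ (b : V) (hb : b ≠ i) (h : a ⟶ b) (x : X.space a),
        e b hb (X.map h x) = M b h (e a ha x)) ∧
      ∀ (h : a ⟶ i) (x : X.space a), M i h (e a ha x) = ε (α a h x) := by
    intro a ha
    obtain ⟨M, hM, hM'⟩ := exists_family (P := fun b => (a ⟶ b) → (S a →ₗ[k] S b)) i
      (fun h => (ε : U →ₗ[k] S i) ∘ₗ α a h ∘ₗ ((e a ha).symm : S a →ₗ[k] X.space a))
      (fun b hb h => (e b hb : X.space b →ₗ[k] S b) ∘ₗ X.map h ∘ₗ
        ((e a ha).symm : S a →ₗ[k] X.space a))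
    refine ⟨M, fun ha' => ⟨fun b hb h x => ?_, fun h x => ?_⟩⟩
    · rw [hM' b hb]
      simp
    · rw [hM]
      simp
  choose R hR using h1
  obtain ⟨M₀, hM₀⟩ : ∃ M : ∀ b, (i ⟶ b) → (S i →ₗ[k] S b),
      ∀ (b : V) (hb : b ≠ i) (h : i ⟶ b) (x : U), M b h (ε x) = e b hb (β b h x) := by
    obtain ⟨M, -, hM'⟩ := exists_family (P := fun b => (i ⟶ b) → (S i →ₗ[k] S b)) i
      (fun _ => 0)
      (fun b hb h => (e b hb : X.space b →ₗ[k] S b) ∘ₗ β b h ∘ₗ (ε.symm : S i →ₗ[k] U))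
    refine ⟨M, fun b hb h x => ?_⟩
    rw [hM' b hb]
    simp
  obtain ⟨M, hM, hM'⟩ := exists_family
    (P := fun a => ∀ b, (a ⟶ b) → (S a →ₗ[k] S b)) i M₀ R
  refine ⟨⟨S, fun {a b} h => M a b h⟩, e, ε, ?_, ?_, ?_⟩
  · intro a b ha hb h x
    change e b hb (X.map h x) = M a b h (e a ha x)
    rw [hM' a ha]
    exact (hR a ha ha).1 b hb h x
  · intro b hb h x
    change M b i h (e b hb x) = _
    rw [hM' b hb]
    exact (hR b hb hb).2 h x
  · intro b hb h x
    change M i b h (ε x) = _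
    rw [hM]
    exact hM₀ b hb h x

end NoLoops

end QuiverRep

/-! ### Kernel and cokernel reflections and their action on morphisms. -/

namespace QuiverRep

open Quiver

variable {k : Type u} [Field k] {V : Type v} [Quiver.{w} V]
  [∀ i : V, IsEmpty (i ⟶ i)] [HasInvolutiveReverse V] [Fintype V] [∀ i j : V, Fintype (i ⟶ j)]

/-- The sum of all maps ending in the vertex `i`. -/
noncomputable def inMap (X : QuiverRep k V) (i : V) :
    (∀ p : Nbr i, X.space p.1) →ₗ[k] X.space i :=
  ∑ p : Nbr i, X.map p.2 ∘ₗ LinearMap.proj p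

/-- The family of all maps starting in the vertex `i`. -/
def outMap (X : QuiverRep k V) (i : V) : X.space i →ₗ[k] ∀ p : Nbr i, X.space p.1 :=
  LinearMap.pi fun p => X.map (reverse p.2)

theorem inMap_apply (X : QuiverRep k V) (i : V) (y : ∀ p : Nbr i, X.space p.1) :
    inMap X i y = ∑ p : Nbr i, X.map p.2 (y p) := by
  simp [inMap]

theorem outMap_apply (X : QuiverRep k V) (i : V) (x : X.space i) (p : Nbr i) :
    outMap X i x p = X.map (reverse p.2) x := rfl

theorem outMap_apply_reverse (X : QuiverRep k V) (i : V) (x : X.space i) {b : V} (h : i ⟶ b) :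
    outMap X i x ⟨b, reverse h⟩ = X.map h x := by
  simp [outMap_apply]

theorem inMap_single [DecidableEq (Nbr (V := V) i)] (X : QuiverRep k V) (p : Nbr i)
    (x : X.space p.1) :
    inMap X i (Pi.single p x) = X.map p.2 x := by
  rw [inMap_apply, Finset.sum_eq_single p]
  · rw [Pi.single_eq_same]
  · intro q _ hq
    rw [Pi.single_eq_of_ne hq, map_zero]
  · simp

theorem Hom.app_inMap {X Y : QuiverRep k V} (f : Hom X Y) (i : V)
    (y : ∀ p : Nbr i, X.space p.1) :
    f.app i (inMap X i y) = inMap Y i fun p => f.app p.1 (y p) := by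
  rw [inMap_apply, inMap_apply, map_sum]
  exact Finset.sum_congr rfl fun p _ => f.comm _ _

theorem Hom.outMap_app {X Y : QuiverRep k V} (f : Hom X Y) (i : V) (x : X.space i) :
    outMap Y i (f.app i x) = fun p => f.app p.1 (outMap X i x p) := by
  funext p
  exact (f.comm _ _).symm

/-- A morphism that is injective away from `i` is injective at `i` if the source has no
subrepresentation concentrated at `i`. -/
theorem Hom.injective_of_injective_outMap {X Y : QuiverRep k V} (f : Hom X Y) {i : V}
    (hf : ∀ j, j ≠ i → Function.Injective (f.app j)) (hX : Function.Injective (outMap X i)) :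
    ∀ j, Function.Injective (f.app j) := by
  intro j
  by_cases hj : j = i
  · subst hj
    rw [injective_iff_map_eq_zero]
    intro x hx
    apply hX
    rw [map_zero]
    funext p
    apply hf _ p.ne
    have := congrFun (f.outMap_app j x) p
    rw [hx, map_zero] at this
    rw [← this]
    simp
  · exact hf j hj

/-- A morphism that is surjective away from `i` is surjective at `i` if the target has no
quotient concentrated at `i`. -/
theorem Hom.surjective_of_surjective_inMap {X Y : QuiverRep k V} (f : Hom X Y) {i : V}
    (hf : ∀ j, j ≠ i → Function.Surjective (f.app j)) (hY : Function.Surjective (inMap Y i)) :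
    ∀ j, Function.Surjective (f.app j) := by
  intro j
  by_cases hj : j = i
  · subst hj
    intro y
    obtain ⟨z, rfl⟩ := hY y
    choose x hx using fun p : Nbr j => hf _ p.ne (z p)
    refine ⟨inMap X j x, ?_⟩
    rw [f.app_inMap]
    exact congrArg _ (funext hx)
  · exact hf j hj

theorem surjective_inMap_of_hom {X Y : QuiverRep k V} (f : Hom X Y) {i : V}
    (hf : Function.Surjective (f.app i)) (hX : Function.Surjective (inMap X i)) :
    Function.Surjective (inMap Y i) := by
  intro y
  obtain ⟨x, rfl⟩ := hf y
  obtain ⟨z, rfl⟩ := hX x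
  exact ⟨_, (f.app_inMap i z).symm⟩

theorem injective_outMap_of_hom {X Y : QuiverRep k V} (f : Hom X Y)
    (hf : ∀ j, Function.Injective (f.app j)) {i : V} (hY : Function.Injective (outMap Y i)) :
    Function.Injective (outMap X i) := by
  rw [injective_iff_map_eq_zero]
  intro x hx
  apply hf i
  apply hY
  rw [f.outMap_app, hx, map_zero, map_zero]
  funext p
  exact map_zero _

/-- The representation `X'` with source `i` is a reflection of the representation `X` with
sink `i`: they agree away from `i`, and the sequence `X'_i → ⨁ X_b → X_i` is exact. -/
structure ReflData (i : V) (X X' : QuiverRep k V) where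
  sink : IsSink i X
  source : IsSource i X'
  e : ∀ j, j ≠ i → (X.space j ≃ₗ[k] X'.space j)
  comm : ∀ {a b : V} (ha : a ≠ i) (hb : b ≠ i) (h : a ⟶ b) (x : X.space a),
    e b hb (X.map h x) = X'.map h (e a ha x)
  exact : ∀ y : ∀ p : Nbr i, X.space p.1,
    inMap X i y = 0 ↔ ∃ x', outMap X' i x' = fun p => e p.1 p.ne (y p)

namespace ReflData

variable {i : V} {X X' Y Y' Z Z' : QuiverRep k V}

theorem comm_symm (D : ReflData i X X') {a b : V} (ha : a ≠ i) (hb : b ≠ i) (h : a ⟶ b)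
    (x : X'.space a) :
    (D.e b hb).symm (X'.map h x) = X.map h ((D.e a ha).symm x) := by
  rw [LinearEquiv.symm_apply_eq, D.comm ha hb, LinearEquiv.apply_symm_apply]

theorem inMap_symm (D : ReflData i X X') (x' : X'.space i) :
    inMap X i (fun p => (D.e p.1 p.ne).symm (outMap X' i x' p)) = 0 := by
  rw [D.exact]
  refine ⟨x', funext fun p => ?_⟩
  rw [LinearEquiv.apply_symm_apply]

/-- The reflection at a sink: `X'_i` is the kernel of the sum of the incoming maps. Injectivity of
`outMap` says that `X'` has no subrepresentation concentrated at `i`. -/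
theorem exists_kernel {X : QuiverRep k V} (hX : IsSink i X) :
    ∃ X', Nonempty (ReflData i X X') ∧ Function.Injective (outMap X' i) := by
  obtain ⟨X', e, ε, h1, h2, h3⟩ := exists_replace X i (LinearMap.ker (inMap X i)) (fun _ _ => 0)
    (fun b h => LinearMap.proj (⟨b, reverse h⟩ : Nbr i) ∘ₗ (LinearMap.ker (inMap X i)).subtype)
  have hout : ∀ (z : LinearMap.ker (inMap X i)) (p : Nbr i),
      outMap X' i (ε z) p = e p.1 p.ne (z.1 p) := by
    rintro z ⟨b, h⟩
    have h4 : ∀ h', h' = h → z.1 ⟨b, h'⟩ = z.1 ⟨b, h⟩ := by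
      rintro _ rfl
      rfl
    rw [outMap_apply, h3 b (ne_of_hom h)]
    exact congrArg _ (h4 _ (reverse_reverse h))
  refine ⟨X', ⟨⟨hX, ?_, e, h1, ?_⟩⟩, ?_⟩
  · intro b h
    ext x
    obtain ⟨y, rfl⟩ := (e b (ne_of_hom h)).surjective x
    rw [h2]
    simp
  · intro y
    constructor
    · intro hy
      exact ⟨ε ⟨y, hy⟩, funext fun p => hout ⟨y, hy⟩ p⟩
    · rintro ⟨x', hx'⟩
      obtain ⟨z, rfl⟩ := ε.surjective x'
      have : z.1 = y := by
        funext p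
        apply (e p.1 p.ne).injective
        rw [← hout]
        exact congrFun hx' p
      rw [← this]
      exact z.2
  · intro x y hxy
    obtain ⟨z, rfl⟩ := ε.surjective x
    obtain ⟨z', rfl⟩ := ε.surjective y
    congr 1
    apply Subtype.ext
    funext p
    apply (e p.1 p.ne).injective
    rw [← hout, hxy, hout]

/-- The reflection at a source: `X_i` is the cokernel of the outgoing maps. Surjectivity of `inMap`
says that `X` has no quotient concentrated at `i`. -/
theorem exists_cokernel {X' : QuiverRep k V} (hX' : IsSource i X') :
    ∃ X, Nonempty (ReflData i X X') ∧ Function.Surjective (inMap X i) := by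
  classical
  obtain ⟨X, e, ε, h1, h2, h3⟩ := exists_replace X' i
    ((∀ p : Nbr i, X'.space p.1) ⧸ LinearMap.range (outMap X' i))
    (fun b h => (LinearMap.range (outMap X' i)).mkQ ∘ₗ
      LinearMap.single k (fun p : Nbr i => X'.space p.1) ⟨b, h⟩)
    (fun b h => 0)
  have hin : ∀ y : ∀ p : Nbr i, X.space p.1, inMap X i y =
      ε ((LinearMap.range (outMap X' i)).mkQ fun p => (e p.1 p.ne).symm (y p)) := by
    intro y
    rw [inMap_apply]
    have h4 : ∀ p : Nbr i, X.map p.2 (y p) = ε ((LinearMap.range (outMap X' i)).mkQ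
        (Pi.single p ((e p.1 p.ne).symm (y p)))) := by
      rintro ⟨b, h⟩
      have := h2 b (ne_of_hom h) h ((e b (ne_of_hom h)).symm (y ⟨b, h⟩))
      rw [LinearEquiv.apply_symm_apply] at this
      exact this
    rw [Finset.sum_congr rfl fun p _ => h4 p, ← map_sum, ← map_sum, Finset.univ_sum_single]
  refine ⟨X, ⟨⟨?_, hX', fun j hj => (e j hj).symm, ?_, ?_⟩⟩, ?_⟩
  · intro b h
    ext x
    obtain ⟨y, rfl⟩ := ε.surjective x
    rw [h3 b (ne_of_hom' h)]
    simp
  · intro a b ha hb h x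
    rw [LinearEquiv.symm_apply_eq, h1 ha hb, LinearEquiv.apply_symm_apply]
  · intro y
    rw [hin, LinearEquiv.map_eq_zero_iff, Submodule.mkQ_apply, Submodule.Quotient.mk_eq_zero]
    rfl
  · intro x
    obtain ⟨q, rfl⟩ := ε.surjective x
    obtain ⟨z, rfl⟩ := Submodule.mkQ_surjective _ q
    refine ⟨fun p => e p.1 p.ne (z p), ?_⟩
    rw [hin]
    simp

theorem exists_linearMap_comp_eq_of_injective {A B N : Type*} [AddCommGroup A] [Module k A]
    [AddCommGroup B] [Module k B] [AddCommGroup N] [Module k N] (o : B →ₗ[k] N) (g : A →ₗ[k] N)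
    (ho : Function.Injective o) (h : ∀ a, ∃ b, o b = g a) :
    ∃ l : A →ₗ[k] B, ∀ a, o (l a) = g a := by
  refine ⟨(LinearEquiv.ofInjective o ho).symm ∘ₗ g.codRestrict (LinearMap.range o) h, fun a => ?_⟩
  have := congrArg Subtype.val ((LinearEquiv.ofInjective o ho).apply_symm_apply
    (g.codRestrict (LinearMap.range o) h a))
  exact this

theorem exists_linearMap_comp_eq_of_surjective {A B N : Type*} [AddCommGroup A] [Module k A]
    [AddCommGroup B] [Module k B] [AddCommGroup N] [Module k N] (s : N →ₗ[k] A) (g : N →ₗ[k] B)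
    (hs : Function.Surjective s) (h : ∀ n, s n = 0 → g n = 0) :
    ∃ l : A →ₗ[k] B, ∀ n, l (s n) = g n := by
  obtain ⟨t, ht⟩ := s.exists_rightInverse_of_surjective (LinearMap.range_eq_top.2 hs)
  refine ⟨g ∘ₗ t, fun n => ?_⟩
  have h1 : s (t (s n) - n) = 0 := by
    rw [map_sub, sub_eq_zero]
    exact LinearMap.congr_fun ht (s n)
  have h2 := h _ h1
  rw [map_sub, sub_eq_zero] at h2
  exact h2

/-- Morphisms reflect, provided that the target has no subrepresentation at `i`. -/
theorem exists_hom (DX : ReflData i X X') (DY : ReflData i Y Y')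
    (hY' : Function.Injective (outMap Y' i)) (f : Hom X Y) :
    ∃ f' : Hom X' Y', ∀ j hj x, f'.app j (DX.e j hj x) = DY.e j hj (f.app j x) := by
  let N : (∀ p : Nbr i, X'.space p.1) →ₗ[k] ∀ p : Nbr i, Y'.space p.1 :=
    LinearMap.pi fun p => (DY.e p.1 p.ne : Y.space p.1 →ₗ[k] Y'.space p.1) ∘ₗ f.app p.1 ∘ₗ
      ((DX.e p.1 p.ne).symm : X'.space p.1 →ₗ[k] X.space p.1) ∘ₗ LinearMap.proj p
  -- The component at `i` is the map induced on kernels of the incoming maps.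
  obtain ⟨g, hg⟩ := exists_linearMap_comp_eq_of_injective (outMap Y' i) (N ∘ₗ outMap X' i) hY' (by
    intro x'
    have h1 := f.app_inMap i fun p => (DX.e p.1 p.ne).symm (outMap X' i x' p)
    rw [DX.inMap_symm, map_zero] at h1
    exact (DY.exact _).1 h1.symm)
  obtain ⟨f', -, hf'⟩ := exists_hom_of_isSource DX.source DY.source
    (fun j hj => (DY.e j hj : Y.space j →ₗ[k] Y'.space j) ∘ₗ f.app j ∘ₗ
      ((DX.e j hj).symm : X'.space j →ₗ[k] X.space j)) (by
      intro a b ha hb h x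
      simp only [LinearMap.comp_apply, LinearEquiv.coe_coe]
      rw [DX.comm_symm ha hb, f.comm, DY.comm ha hb]) g (by
      intro b hb h x
      have := congrFun (hg x) ⟨b, reverse h⟩
      rw [outMap_apply_reverse] at this
      rw [this]
      simp only [N, LinearMap.comp_apply, LinearMap.pi_apply, LinearMap.proj_apply,
        outMap_apply_reverse])
  refine ⟨f', fun j hj x => ?_⟩
  rw [hf' j hj]
  simp

/-- Morphisms reflect back, provided that the source has no quotient at `i`. -/
theorem exists_hom_back (DX : ReflData i X X') (DY : ReflData i Y Y')
    (hX : Function.Surjective (inMap X i)) (f' : Hom X' Y') :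
    ∃ f : Hom X Y, ∀ j hj x, f'.app j (DX.e j hj x) = DY.e j hj (f.app j x) := by
  classical
  let N : (∀ p : Nbr i, X.space p.1) →ₗ[k] ∀ p : Nbr i, Y.space p.1 :=
    LinearMap.pi fun p => ((DY.e p.1 p.ne).symm : Y'.space p.1 →ₗ[k] Y.space p.1) ∘ₗ
      f'.app p.1 ∘ₗ (DX.e p.1 p.ne : X.space p.1 →ₗ[k] X'.space p.1) ∘ₗ LinearMap.proj p
  -- The component at `i` is the map induced on cokernels of the outgoing maps.
  obtain ⟨g, hg⟩ := exists_linearMap_comp_eq_of_surjective (inMap X i) (inMap Y i ∘ₗ N) hX (by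
    intro y hy
    obtain ⟨x', hx'⟩ := (DX.exact y).1 hy
    refine (DY.exact _).2 ⟨f'.app i x', ?_⟩
    rw [f'.outMap_app, hx']
    simp [N])
  obtain ⟨f, -, hf⟩ := exists_hom_of_isSink DX.sink DY.sink
    (fun j hj => ((DY.e j hj).symm : Y'.space j →ₗ[k] Y.space j) ∘ₗ f'.app j ∘ₗ
      (DX.e j hj : X.space j →ₗ[k] X'.space j)) (by
      intro a b ha hb h x
      simp only [LinearMap.comp_apply, LinearEquiv.coe_coe]
      rw [DX.comm ha hb, f'.comm, DY.comm_symm ha hb]) g (by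
      intro b hb h x
      have h1 := hg (Pi.single (⟨b, h⟩ : Nbr i) x)
      rw [inMap_single] at h1
      rw [h1, LinearMap.comp_apply]
      have h2 : N (Pi.single (⟨b, h⟩ : Nbr i) x) = Pi.single (⟨b, h⟩ : Nbr i)
          ((DY.e b hb).symm (f'.app b (DX.e b hb x))) := by
        funext p
        by_cases hp : p = ⟨b, h⟩
        · subst hp
          simp [N]
        · simp [N, hp]
      rw [h2, inMap_single]
      rfl)
  refine ⟨f, fun j hj x => ?_⟩
  rw [hf j hj]
  simp

theorem injective_iff (DX : ReflData i X X') (DY : ReflData i Y Y') {f : Hom X Y}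
    {f' : Hom X' Y'} (h : ∀ j hj x, f'.app j (DX.e j hj x) = DY.e j hj (f.app j x)) {j : V}
    (hj : j ≠ i) : Function.Injective (f'.app j) ↔ Function.Injective (f.app j) := by
  have h1 : f'.app j ∘ DX.e j hj = DY.e j hj ∘ f.app j := funext (h j hj)
  rw [← (DY.e j hj).injective.of_comp_iff, ← h1, Function.Injective.of_comp_iff']
  exact (DX.e j hj).bijective

theorem surjective_iff (DX : ReflData i X X') (DY : ReflData i Y Y') {f : Hom X Y}
    {f' : Hom X' Y'} (h : ∀ j hj x, f'.app j (DX.e j hj x) = DY.e j hj (f.app j x)) {j : V}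
    (hj : j ≠ i) : Function.Surjective (f'.app j) ↔ Function.Surjective (f.app j) := by
  have h1 : f'.app j ∘ DX.e j hj = DY.e j hj ∘ f.app j := funext (h j hj)
  rw [← (DX.e j hj).surjective.of_comp_iff, h1, Function.Surjective.of_comp_iff']
  exact (DY.e j hj).bijective

theorem exact_iff (DX : ReflData i X X') (DY : ReflData i Y Y') (DZ : ReflData i Z Z')
    {f : Hom X Y} {f' : Hom X' Y'} {g : Hom Y Z} {g' : Hom Y' Z'}
    (h : ∀ j hj x, f'.app j (DX.e j hj x) = DY.e j hj (f.app j x))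
    (h' : ∀ j hj x, g'.app j (DY.e j hj x) = DZ.e j hj (g.app j x)) {j : V} (hj : j ≠ i) :
    Function.Exact (f'.app j) (g'.app j) ↔ Function.Exact (f.app j) (g.app j) := by
  constructor
  · intro he y
    have h1 := he (DY.e j hj y)
    rw [h', LinearEquiv.map_eq_zero_iff] at h1
    rw [h1]
    constructor
    · rintro ⟨x, hx⟩
      obtain ⟨x, rfl⟩ := (DX.e j hj).surjective x
      rw [h] at hx
      exact ⟨x, (DY.e j hj).injective hx⟩
    · rintro ⟨x, rfl⟩
      exact ⟨DX.e j hj x, h j hj x⟩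
  · intro he y
    obtain ⟨y, rfl⟩ := (DY.e j hj).surjective y
    rw [h', LinearEquiv.map_eq_zero_iff, he y]
    constructor
    · rintro ⟨x, rfl⟩
      exact ⟨DX.e j hj x, h j hj x⟩
    · rintro ⟨x, hx⟩
      obtain ⟨x, rfl⟩ := (DX.e j hj).surjective x
      rw [h] at hx
      exact ⟨x, (DY.e j hj).injective hx⟩

end ReflData

end QuiverRep

/-! ### Isomorphism criteria and simple representations. -/

namespace QuiverRep

open Quiver

variable {k : Type u} [Field k] {V : Type v} [Quiver.{w} V]

/-- Dimensions agree at every vertex. With this criterion, reflections of mutually inverse morphisms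
need not be shown to be mutually inverse. -/
theorem isomorphic_of_injective {X Y : QuiverRep k V} (f : Hom X Y) (g : Hom Y X)
    (hf : ∀ i, Function.Injective (f.app i)) (hg : ∀ i, Function.Injective (g.app i)) :
    Isomorphic X Y := by
  refine ⟨f, fun i => ⟨hf i, ?_⟩⟩
  refine (LinearMap.injective_iff_surjective_of_finrank_eq_finrank (le_antisymm ?_ ?_)).1 (hf i)
  · exact LinearMap.finrank_le_finrank_of_injective (hf i)
  · exact LinearMap.finrank_le_finrank_of_injective (hg i)

theorem isomorphic_of_surjective {X Y : QuiverRep k V} (f : Hom X Y) (g : Hom Y X)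
    (hf : ∀ i, Function.Surjective (f.app i)) (hg : ∀ i, Function.Surjective (g.app i)) :
    Isomorphic X Y := by
  refine ⟨f, fun i => ⟨?_, hf i⟩⟩
  refine (LinearMap.injective_iff_surjective_of_finrank_eq_finrank (le_antisymm ?_ ?_)).2 (hf i)
  · have := LinearMap.finrank_range_le (g.app i)
    rwa [LinearMap.range_eq_top.2 (hg i), finrank_top] at this
  · have := LinearMap.finrank_range_le (f.app i)
    rwa [LinearMap.range_eq_top.2 (hf i), finrank_top] at this

theorem IsSink.quotient {X Y : QuiverRep k V} {i : V} (hX : IsSink i X) (f : Hom X Y)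
    (hf : ∀ i, Function.Surjective (f.app i)) : IsSink i Y := by
  intro b a
  ext y
  obtain ⟨x, rfl⟩ := hf _ y
  rw [← f.comm, hX b a]
  simp

theorem IsSource.quotient {X Y : QuiverRep k V} {i : V} (hX : IsSource i X) (f : Hom X Y)
    (hf : ∀ i, Function.Surjective (f.app i)) : IsSource i Y := by
  intro b a
  ext y
  obtain ⟨x, rfl⟩ := hf _ y
  rw [← f.comm, hX b a]
  simp

theorem fstHom_surjective (X Y : QuiverRep k V) (i : V) :
    Function.Surjective ((fstHom X Y).app i) := Prod.fst_surjective (β := Y.space i)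

theorem sndHom_surjective (X Y : QuiverRep k V) (i : V) :
    Function.Surjective ((sndHom X Y).app i) := Prod.snd_surjective (α := X.space i)

/-- The second inclusion of a direct sum. -/
def inrHom (X Y : QuiverRep k V) : Hom Y (X.prod Y) :=
  ⟨fun i => LinearMap.inr k (X.space i) (Y.space i), fun a x => by
    change ((0 : X.space _), Y.map a x) = (X.map a 0, Y.map a x)
    rw [map_zero]⟩

theorem inlHom_injective (X Y : QuiverRep k V) (i : V) :
    Function.Injective ((inlHom X Y).app i) :=
  LinearMap.inl_injective (R := k) (M := X.space i) (M₂ := Y.space i)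

theorem inrHom_injective (X Y : QuiverRep k V) (i : V) :
    Function.Injective ((inrHom X Y).app i) :=
  LinearMap.inr_injective (R := k) (M := X.space i) (M₂ := Y.space i)

section Simple

variable [DecidableEq V]

theorem subsingleton_of_dimVec_eq_stdVec {X : QuiverRep k V} {i : V}
    (hX : X.dimVec = QuiverTF.stdVec i) {j : V} (hj : j ≠ i) : Subsingleton (X.space j) := by
  rw [← dimVec_apply_eq_zero_iff, hX]
  simp [QuiverTF.stdVec, hj]

theorem indecomposable_of_dimVec_eq_stdVec [Fintype V] {X : QuiverRep k V} {i : V}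
    (hX : X.dimVec = QuiverTF.stdVec i) : X.Indecomposable := by
  refine ⟨fun h => ?_, fun A B hAB => ?_⟩
  · rw [isZero_iff_dimVec, hX] at h
    have := congrFun h i
    simp [QuiverTF.stdVec] at this
  · have h1 : A.totalDim + B.totalDim = 1 := by
      rw [← totalDim_prod, totalDim, ← hAB.dimVec_eq, hX]
      simp [QuiverTF.stdVec]
    by_contra h
    rw [not_or] at h
    have := totalDim_pos h.1
    have := totalDim_pos h.2
    omega

theorem exists_dimVec_eq_stdVec (k : Type u) [Field k] (i : V) :
    ∃ S : QuiverRep k V, S.dimVec = QuiverTF.stdVec i := by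
  refine ⟨⟨fun j => Fin (if j = i then 1 else 0) → k, fun _ => 0⟩, funext fun j => ?_⟩
  by_cases h : j = i
  · subst h
    simp [dimVec, QuiverTF.stdVec]
  · simp [dimVec, QuiverTF.stdVec, h]

theorem exists_sub_dimVec_eq_stdVec {X : QuiverRep k V} {i : V} (v : X.space i) (hv : v ≠ 0)
    (h : ∀ (b : V) (a : i ⟶ b), X.map a v = 0) :
    ∃ (S : QuiverRep k V) (f : Hom S X), S.dimVec = QuiverTF.stdVec i ∧
      ∀ j, Function.Injective (f.app j) := by
  obtain ⟨p, hp, hp'⟩ := exists_family (P := fun j => Submodule k (X.space j)) i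
    (Submodule.span k {v}) fun j _ => ⊥
  have hs : ∀ {a b : V} (f : a ⟶ b), ∀ x ∈ p a, X.map f x ∈ p b := by
    intro a b f x hx
    by_cases ha : a = i
    · subst ha
      rw [hp] at hx
      obtain ⟨r, rfl⟩ := Submodule.mem_span_singleton.1 hx
      rw [map_smul, h, smul_zero]
      exact zero_mem _
    · rw [hp' a ha, Submodule.mem_bot] at hx
      rw [hx, map_zero]
      exact zero_mem _
  refine ⟨X.subrep p hs, subrepHom hs, funext fun j => ?_, subrepHom_injective hs⟩
  change (Module.finrank k (p j) : ℤ) = _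
  by_cases hj : j = i
  · subst hj
    rw [hp, finrank_span_singleton hv]
    simp [QuiverTF.stdVec]
  · rw [hp' j hj, finrank_bot]
    simp [QuiverTF.stdVec, hj]

variable [∀ i : V, IsEmpty (i ⟶ i)]

theorem isomorphic_of_dimVec_eq_stdVec {X Y : QuiverRep k V} {i : V}
    (hX : X.dimVec = QuiverTF.stdVec i) (hY : Y.dimVec = QuiverTF.stdVec i) :
    Isomorphic X Y := by
  have h1 : ∀ j, Module.finrank k (X.space j) = Module.finrank k (Y.space j) := fun j => by
    have := congrFun (hX.trans hY.symm) j
    simpa [dimVec] using this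
  refine ⟨⟨fun j => (LinearEquiv.ofFinrankEq _ _ (h1 j) : X.space j →ₗ[k] Y.space j),
    fun {a b} f x => ?_⟩, fun j => (LinearEquiv.ofFinrankEq _ _ (h1 j)).bijective⟩
  by_cases ha : a = i
  · have hb : b ≠ i := ha ▸ ne_of_hom' f
    have := subsingleton_of_dimVec_eq_stdVec hY hb
    exact Subsingleton.elim _ _
  · have := subsingleton_of_dimVec_eq_stdVec hX ha
    rw [Subsingleton.elim x 0]
    simp

theorem Indecomposable.dimVec_eq_stdVec {X : QuiverRep k V} (hX : X.Indecomposable) {i : V}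
    (h : ∀ j, j ≠ i → Subsingleton (X.space j)) : X.dimVec = QuiverTF.stdVec i := by
  have hi : ¬ Subsingleton (X.space i) := by
    intro hi
    refine hX.1 fun j => ?_
    by_cases hj : j = i
    · exact hj ▸ hi
    · exact h j hj
  rw [not_subsingleton_iff_nontrivial] at hi
  obtain ⟨v, hv⟩ := exists_ne (0 : X.space i)
  have hzero : ∀ {a b : V} (f : a ⟶ b) (x : X.space a), X.map f x = 0 := by
    intro a b f x
    by_cases ha : a = i
    · have := h b (ha ▸ ne_of_hom' f)
      exact Subsingleton.elim _ _
    · have := h a ha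
      rw [Subsingleton.elim x 0, map_zero]
  obtain ⟨q₀, hq₀⟩ := Submodule.exists_isCompl (Submodule.span k {v})
  obtain ⟨p, hp, hp'⟩ := exists_family (P := fun j => Submodule k (X.space j)) i
    (Submodule.span k {v}) fun j _ => ⊥
  obtain ⟨q, hq, hq'⟩ := exists_family (P := fun j => Submodule k (X.space j)) i
    q₀ fun j _ => ⊤
  rcases hX.eq_bot_or_eq_bot (p := p) (q := q)
    (fun f x _ => by rw [hzero]; exact zero_mem _)
    (fun f x _ => by rw [hzero]; exact zero_mem _) (fun j => by
      by_cases hj : j = i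
      · subst hj
        rwa [hp, hq]
      · rw [hp' j hj, hq' j hj]
        exact isCompl_bot_top) with h1 | h1
  · exfalso
    have := h1 i
    rw [hp, Submodule.span_singleton_eq_bot] at this
    exact hv this
  · have h2 := h1 i
    rw [hq] at h2
    rw [h2] at hq₀
    have h3 := eq_top_of_isCompl_bot hq₀
    funext j
    by_cases hj : j = i
    · subst hj
      have h4 : Module.finrank k (X.space j) = 1 := by
        rw [← finrank_top k, ← h3, finrank_span_singleton hv]
      simp [dimVec, QuiverTF.stdVec, h4]
    · rw [dimVec_apply_eq_zero_iff.2 (h j hj)]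
      simp [QuiverTF.stdVec, hj]

variable [HasInvolutiveReverse V] [Fintype V] [∀ i j : V, Fintype (i ⟶ j)]

/-- An indecomposable representation with sink `i` is the simple one at `i` or has no quotient
at `i`. -/
theorem Indecomposable.dimVec_eq_or_surjective {X : QuiverRep k V} (hX : X.Indecomposable)
    {i : V} (hi : IsSink i X) :
    X.dimVec = QuiverTF.stdVec i ∨ Function.Surjective (inMap X i) := by
  classical
  -- The image of `inMap` together with all other spaces is a subrepresentation, and so is any
  -- complement of that image at the sink `i`; hence `X` splits.
  obtain ⟨q₀, hq₀⟩ := Submodule.exists_isCompl (LinearMap.range (inMap X i))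
  obtain ⟨p, hp, hp'⟩ := exists_family (P := fun j => Submodule k (X.space j)) i
    (LinearMap.range (inMap X i)) fun j _ => ⊤
  obtain ⟨q, hq, hq'⟩ := exists_family (P := fun j => Submodule k (X.space j)) i
    q₀ fun j _ => ⊥
  rcases hX.eq_bot_or_eq_bot (p := p) (q := q)
    (fun {a b} f x _ => by
      by_cases hb : b = i
      · subst hb
        rw [hp]
        exact ⟨Pi.single (⟨a, f⟩ : Nbr b) x, inMap_single X ⟨a, f⟩ x⟩
      · rw [hp' b hb]
        trivial)
    (fun {a b} f x hx => by
      by_cases ha : a = i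
      · subst ha
        rw [hi b f]
        exact zero_mem _
      · rw [hq' a ha, Submodule.mem_bot] at hx
        rw [hx, map_zero]
        exact zero_mem _) (fun j => by
      by_cases hj : j = i
      · subst hj
        rwa [hp, hq]
      · rw [hp' j hj, hq' j hj]
        exact isCompl_top_bot) with h1 | h1
  · left
    refine hX.dimVec_eq_stdVec fun j hj => ?_
    have := h1 j
    rw [hp' j hj] at this
    exact (Submodule.subsingleton_iff k).1 (subsingleton_of_bot_eq_top this.symm)
  · right
    have h2 := h1 i
    rw [hq] at h2
    rw [h2] at hq₀
    exact LinearMap.range_eq_top.1 (eq_top_of_isCompl_bot hq₀)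

theorem not_surjective_of_dimVec_eq_stdVec {X : QuiverRep k V} {i : V}
    (hX : X.dimVec = QuiverTF.stdVec i) : ¬ Function.Surjective (inMap X i) := by
  intro h
  have h1 : Subsingleton (X.space i) := by
    have : ∀ p : Nbr i, Subsingleton (X.space p.1) := fun p =>
      subsingleton_of_dimVec_eq_stdVec hX p.ne
    exact h.subsingleton
  rw [← dimVec_apply_eq_zero_iff, hX] at h1
  simp [QuiverTF.stdVec] at h1

end Simple

end QuiverRep

/-! ### Reflection of exact sequences, direct sums, indecomposables and dimension vectors. -/

namespace QuiverRep

open Quiver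

variable {k : Type u} [Field k] {V : Type v} [Quiver.{w} V]
  [∀ i : V, IsEmpty (i ⟶ i)] [HasInvolutiveReverse V] [Fintype V] [∀ i j : V, Fintype (i ⟶ j)]

/-- The simple reflection at `i` of the root lattice of a symmetric quiver. -/
def reflVec [DecidableEq V] (i : V) (x : V → ℤ) : V → ℤ :=
  Function.update x i (∑ p : Nbr i, x p.1 - x i)

theorem reflVec_apply_self [DecidableEq V] (i : V) (x : V → ℤ) :
    reflVec i x i = ∑ b, (Fintype.card (b ⟶ i) : ℤ) * x b - x i := by
  rw [reflVec, Function.update_self, Fintype.sum_sigma]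
  simp

theorem reflVec_reflVec [DecidableEq V] (i : V) (x : V → ℤ) : reflVec i (reflVec i x) = x := by
  funext j
  by_cases hj : j = i
  · subst hj
    have : ∀ p : Nbr j, reflVec j x p.1 = x p.1 := fun p => by simp [reflVec, p.ne]
    rw [reflVec, Function.update_self, Finset.sum_congr rfl fun p _ => this p]
    simp [reflVec]
  · simp [reflVec, hj]

namespace ReflData

variable {i : V} {X X' Y Y' Z Z' : QuiverRep k V}

theorem injective_hom (DX : ReflData i X X') (DY : ReflData i Y Y') {f : Hom X Y}
    {f' : Hom X' Y'} (h : ∀ j hj x, f'.app j (DX.e j hj x) = DY.e j hj (f.app j x))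
    (hX' : Function.Injective (outMap X' i)) (hf : ∀ j, Function.Injective (f.app j)) :
    ∀ j, Function.Injective (f'.app j) :=
  f'.injective_of_injective_outMap (fun _ hj => (injective_iff DX DY h hj).2 (hf _)) hX'

theorem surjective_hom_back (DX : ReflData i X X') (DY : ReflData i Y Y') {f : Hom X Y}
    {f' : Hom X' Y'} (h : ∀ j hj x, f'.app j (DX.e j hj x) = DY.e j hj (f.app j x))
    (hY : Function.Surjective (inMap Y i)) (hf : ∀ j, Function.Surjective (f'.app j)) :
    ∀ j, Function.Surjective (f.app j) :=
  f.surjective_of_surjective_inMap (fun _ hj => (surjective_iff DX DY h hj).1 (hf _)) hY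

theorem isomorphic (DX : ReflData i X X') (DY : ReflData i Y Y')
    (hX' : Function.Injective (outMap X' i)) (hY' : Function.Injective (outMap Y' i))
    (h : Isomorphic X Y) : Isomorphic X' Y' := by
  obtain ⟨g, hg⟩ := h.symm
  obtain ⟨f, hf⟩ := h
  obtain ⟨f', h1⟩ := exists_hom DX DY hY' f
  obtain ⟨g', h2⟩ := exists_hom DY DX hX' g
  exact isomorphic_of_injective f' g' (injective_hom DX DY h1 hX' fun j => (hf j).1)
    (injective_hom DY DX h2 hY' fun j => (hg j).1)

theorem isomorphic_back (DX : ReflData i X X') (DY : ReflData i Y Y')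
    (hX : Function.Surjective (inMap X i)) (hY : Function.Surjective (inMap Y i))
    (h : Isomorphic X' Y') : Isomorphic X Y := by
  obtain ⟨g, hg⟩ := h.symm
  obtain ⟨f, hf⟩ := h
  obtain ⟨f', h1⟩ := exists_hom_back DX DY hX f
  obtain ⟨g', h2⟩ := exists_hom_back DY DX hY g
  exact isomorphic_of_surjective f' g' (surjective_hom_back DX DY h1 hY fun j => (hf j).2)
    (surjective_hom_back DY DX h2 hX fun j => (hg j).2)

/-- Reflection preserves left exact sequences. -/
theorem exact_hom (DX : ReflData i X X') (DY : ReflData i Y Y') (DZ : ReflData i Z Z')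
    (hY' : Function.Injective (outMap Y' i)) (hZ' : Function.Injective (outMap Z' i))
    {f : Hom X Y} {f' : Hom X' Y'} {g : Hom Y Z} {g' : Hom Y' Z'}
    (h : ∀ j hj x, f'.app j (DX.e j hj x) = DY.e j hj (f.app j x))
    (h' : ∀ j hj x, g'.app j (DY.e j hj x) = DZ.e j hj (g.app j x))
    (hf : ∀ j, Function.Injective (f.app j))
    (he : ∀ j, Function.Exact (f.app j) (g.app j)) (j : V) :
    Function.Exact (f'.app j) (g'.app j) := by
  by_cases hj : j = i
  swap
  · exact (exact_iff DX DY DZ h h' hj).2 (he j)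
  have he' : ∀ p : Nbr i, Function.Exact (f'.app p.1) (g'.app p.1) := fun p =>
    (exact_iff DX DY DZ h h' p.ne).2 (he p.1)
  subst hj
  intro y'
  constructor
  · intro hy'
    -- The neighbouring components of `y'` lift to `X`. Since `f` is injective at `j`, the lifted
    -- family lies in the kernel of `inMap X j`, hence comes from `X'_j`.
    have h1 : ∀ p : Nbr j, ∃ l, f.app p.1 l = (DY.e p.1 p.ne).symm (outMap Y' j y' p) := by
      intro p
      apply (he p.1 _).1
      apply (DZ.e p.1 p.ne).injective
      rw [← h', LinearEquiv.apply_symm_apply, ← congrFun (g'.outMap_app j y') p, hy']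
      simp
    choose l hl using h1
    have h2 : inMap X j l = 0 := by
      apply hf j
      rw [f.app_inMap, map_zero, funext hl, DY.inMap_symm]
    obtain ⟨x', hx'⟩ := (DX.exact l).1 h2
    refine ⟨x', hY' ?_⟩
    rw [f'.outMap_app, hx']
    funext p
    rw [h, hl, LinearEquiv.apply_symm_apply]
  · rintro ⟨x', rfl⟩
    apply hZ'
    rw [g'.outMap_app, f'.outMap_app, map_zero]
    funext p
    exact (he' p _).2 ⟨_, rfl⟩

/-- Reflecting back preserves short exact sequences of representations without
subrepresentations concentrated at `i`. -/
theorem exact_hom_back (DX : ReflData i X X') (DY : ReflData i Y Y') (DZ : ReflData i Z Z')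
    (hX : Function.Surjective (inMap X i)) (hY : Function.Surjective (inMap Y i))
    (hZ' : Function.Injective (outMap Z' i))
    {f : Hom X Y} {f' : Hom X' Y'} {g : Hom Y Z} {g' : Hom Y' Z'}
    (h : ∀ j hj x, f'.app j (DX.e j hj x) = DY.e j hj (f.app j x))
    (h' : ∀ j hj x, g'.app j (DY.e j hj x) = DZ.e j hj (g.app j x))
    (hf : ∀ j, Function.Injective (f'.app j))
    (he : ∀ j, Function.Exact (f'.app j) (g'.app j))
    (hg : ∀ j, Function.Surjective (g'.app j)) (j : V) :
    Function.Injective (f.app j) ∧ Function.Exact (f.app j) (g.app j) := by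
  by_cases hj : j = i
  swap
  · exact ⟨(injective_iff DX DY h hj).1 (hf j), (exact_iff DX DY DZ h h' hj).1 (he j)⟩
  have he' : ∀ p : Nbr i, Function.Exact (f.app p.1) (g.app p.1) := fun p =>
    (exact_iff DX DY DZ h h' p.ne).1 (he p.1)
  subst hj
  constructor
  · rw [injective_iff_map_eq_zero]
    intro x hx
    obtain ⟨n, rfl⟩ := hX x
    rw [f.app_inMap] at hx
    obtain ⟨y', hy'⟩ := (DY.exact _).1 hx
    have h1 : g'.app j y' = 0 := by
      apply hZ'
      rw [g'.outMap_app, hy', map_zero]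
      funext p
      exact (he p.1 _).2 ⟨DX.e p.1 p.ne (n p), h _ _ _⟩
    obtain ⟨x', rfl⟩ := (he j _).1 h1
    refine (DX.exact n).2 ⟨x', funext fun p => hf p.1 ?_⟩
    rw [h, ← congrFun (f'.outMap_app j x') p, hy']
  · intro y
    constructor
    · intro hy
      obtain ⟨n, rfl⟩ := hY y
      rw [g.app_inMap] at hy
      obtain ⟨z', hz'⟩ := (DZ.exact _).1 hy
      -- Surjectivity of `g'` lifts the correction to `Y'_j`. Subtracting its outgoing components
      -- from `n` leaves `inMap Y j n` unchanged and makes every component die in `Z`.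
      obtain ⟨y', rfl⟩ := hg j z'
      have h1 : ∀ p : Nbr j, ∃ l, f.app p.1 l =
          n p - (DY.e p.1 p.ne).symm (outMap Y' j y' p) := by
        intro p
        apply (he' p _).1
        rw [map_sub, sub_eq_zero]
        apply (DZ.e p.1 p.ne).injective
        rw [← h' _ p.ne ((DY.e p.1 p.ne).symm _), LinearEquiv.apply_symm_apply,
          ← congrFun (g'.outMap_app j y') p, hz']
      choose l hl using h1
      refine ⟨inMap X j l, ?_⟩
      have h2 : (fun p => f.app p.1 (l p)) =
          n - fun p : Nbr j => (DY.e p.1 p.ne).symm (outMap Y' j y' p) := funext hl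
      rw [f.app_inMap, h2, map_sub, DY.inMap_symm, sub_zero]
    · rintro ⟨x, rfl⟩
      obtain ⟨n, rfl⟩ := hX x
      rw [f.app_inMap, g.app_inMap]
      have : (fun p : Nbr j => g.app p.1 (f.app p.1 (n p))) = 0 :=
        funext fun p => (he' p _).2 ⟨_, rfl⟩
      rw [this, map_zero]

theorem inMap_prod (X Y : QuiverRep k V) (y : ∀ p : Nbr i, (X.prod Y).space p.1) :
    inMap (X.prod Y) i y =
      (inMap X i (fun p => (fstHom X Y).app p.1 (y p)),
        inMap Y i fun p => (sndHom X Y).app p.1 (y p)) :=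
  Prod.ext ((fstHom X Y).app_inMap i y) ((sndHom X Y).app_inMap i y)

/-- Reflections are compatible with direct sums. -/
def prod (DX : ReflData i X X') (DY : ReflData i Y Y') :
    ReflData i (X.prod Y) (X'.prod Y') where
  sink b a := by
    change (X.map a).prodMap (Y.map a) = 0
    rw [DX.sink, DY.sink, LinearMap.prodMap_zero]
  source b a := by
    change (X'.map a).prodMap (Y'.map a) = 0
    rw [DX.source, DY.source, LinearMap.prodMap_zero]
  e j hj := (DX.e j hj).prodCongr (DY.e j hj)
  comm ha hb h x := Prod.ext (DX.comm ha hb h x.1) (DY.comm ha hb h x.2)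
  exact y := by
    rw [inMap_prod]
    refine Prod.mk_eq_zero.trans ?_
    rw [DX.exact, DY.exact]
    constructor
    · rintro ⟨⟨x, hx⟩, ⟨x', hx'⟩⟩
      exact ⟨(x, x'), funext fun p => Prod.ext (congrFun hx p) (congrFun hx' p)⟩
    · rintro ⟨x, hx⟩
      exact ⟨⟨x.1, funext fun p => congrArg Prod.fst (congrFun hx p)⟩,
        ⟨x.2, funext fun p => congrArg Prod.snd (congrFun hx p)⟩⟩

theorem surjective_inMap_prod (hX : Function.Surjective (inMap X i))
    (hY : Function.Surjective (inMap Y i)) : Function.Surjective (inMap (X.prod Y) i) := by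
  rintro ⟨x, y⟩
  obtain ⟨a, rfl⟩ := hX x
  obtain ⟨b, rfl⟩ := hY y
  exact ⟨fun p => (a p, b p), inMap_prod X Y _⟩

theorem injective_outMap_prod (hX : Function.Injective (outMap X i))
    (hY : Function.Injective (outMap Y i)) : Function.Injective (outMap (X.prod Y) i) := by
  rintro ⟨x, y⟩ ⟨x', y'⟩ h
  exact Prod.ext (hX (funext fun p => congrArg Prod.fst (congrFun h p)))
    (hY (funext fun p => congrArg Prod.snd (congrFun h p)))

theorem isZero (D : ReflData i X X') (hX' : Function.Injective (outMap X' i)) (h : X.IsZero) :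
    X'.IsZero := by
  have h1 : ∀ j, j ≠ i → Subsingleton (X'.space j) := fun j hj => by
    have := h j
    exact (D.e j hj).symm.injective.subsingleton
  intro j
  by_cases hj : j = i
  · subst hj
    have := fun p : Nbr j => h1 p.1 p.ne
    exact hX'.subsingleton
  · exact h1 j hj

theorem isZero_back (D : ReflData i X X') (hX : Function.Surjective (inMap X i))
    (h : X'.IsZero) : X.IsZero := by
  have h1 : ∀ j, j ≠ i → Subsingleton (X.space j) := fun j hj => by
    have := h j
    exact (D.e j hj).injective.subsingleton
  intro j
  by_cases hj : j = i
  · subst hj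
    have := fun p : Nbr j => h1 p.1 p.ne
    exact hX.subsingleton
  · exact h1 j hj

/-- A splitting of `X'` reflects back to a splitting of `X`, one of whose parts is zero. The
corresponding summand of `X'` then vanishes too, because it inherits from `X'` the absence of
subrepresentations at `i`. -/
theorem indecomposable (D : ReflData i X X') (hX : Function.Surjective (inMap X i))
    (hX' : Function.Injective (outMap X' i)) (h : X.Indecomposable) : X'.Indecomposable := by
  refine ⟨fun h' => h.1 (D.isZero_back hX h'), fun A' B' hAB => ?_⟩
  obtain ⟨f, hf⟩ := hAB
  obtain ⟨A, ⟨DA⟩, hA⟩ := exists_cokernel (D.source.quotient ((fstHom A' B').comp f) fun i =>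
    (fstHom_surjective A' B' i).comp (hf i).2)
  obtain ⟨B, ⟨DB⟩, hB⟩ := exists_cokernel (D.source.quotient ((sndHom A' B').comp f) fun i =>
    (sndHom_surjective A' B' i).comp (hf i).2)
  have h1 := isomorphic_back D (DA.prod DB) hX (surjective_inMap_prod hA hB) ⟨f, hf⟩
  obtain ⟨g, -, hg⟩ := f.exists_inverse hf
  have hg' : ∀ j, Function.Injective (g.app j) := fun j =>
    Function.LeftInverse.injective (g := f.app j) (hg j)
  refine (h.2 _ _ h1).imp (DA.isZero ?_) (DB.isZero ?_)
  · exact injective_outMap_of_hom (g.comp (inlHom A' B'))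
      (fun j => (hg' j).comp (inlHom_injective A' B' j)) hX'
  · exact injective_outMap_of_hom (g.comp (inrHom A' B'))
      (fun j => (hg' j).comp (inrHom_injective A' B' j)) hX'

theorem indecomposable_back (D : ReflData i X X') (hX : Function.Surjective (inMap X i))
    (hX' : Function.Injective (outMap X' i)) (h : X'.Indecomposable) : X.Indecomposable := by
  refine ⟨fun h' => h.1 (D.isZero hX' h'), fun A B hAB => ?_⟩
  obtain ⟨f, hf⟩ := hAB
  obtain ⟨A', ⟨DA⟩, hA⟩ := exists_kernel (D.sink.quotient ((fstHom A B).comp f) fun i =>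
    (fstHom_surjective A B i).comp (hf i).2)
  obtain ⟨B', ⟨DB⟩, hB⟩ := exists_kernel (D.sink.quotient ((sndHom A B).comp f) fun i =>
    (sndHom_surjective A B i).comp (hf i).2)
  have h1 := isomorphic D (DA.prod DB) hX' (injective_outMap_prod hA hB) ⟨f, hf⟩
  refine (h.2 _ _ h1).imp (DA.isZero_back ?_) (DB.isZero_back ?_)
  · exact surjective_inMap_of_hom ((fstHom A B).comp f) ((fstHom_surjective A B i).comp (hf i).2) hX
  · exact surjective_inMap_of_hom ((sndHom A B).comp f) ((sndHom_surjective A B i).comp (hf i).2) hX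

/-- Under both conditions `0 → X'_i → ⨁ X_b → X_i → 0` is exact, and dimensions are counted. -/
theorem dimVec_eq [DecidableEq V] (D : ReflData i X X') (hX : Function.Surjective (inMap X i))
    (hX' : Function.Injective (outMap X' i)) : X'.dimVec = reflVec i X.dimVec := by
  have hne : ∀ j, j ≠ i → X'.dimVec j = X.dimVec j := fun j hj => by
    simp only [dimVec]
    rw [(D.e j hj).finrank_eq]
  funext j
  by_cases hj : j = i
  swap
  · simp [reflVec, hj, hne j hj]
  subst hj
  let N : (∀ p : Nbr j, X.space p.1) ≃ₗ[k] ∀ p : Nbr j, X'.space p.1 :=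
    LinearEquiv.piCongrRight fun p => D.e p.1 p.ne
  have h1 : (LinearMap.ker (inMap X j)).map (N : (∀ p : Nbr j, X.space p.1) →ₗ[k] _) =
      LinearMap.range (outMap X' j) := by
    ext y
    constructor
    · rintro ⟨x, hx, rfl⟩
      exact (D.exact x).1 hx
    · rintro ⟨x', rfl⟩
      exact ⟨_, D.inMap_symm x', funext fun p => LinearEquiv.apply_symm_apply _ _⟩
  have h2 := LinearMap.finrank_range_add_finrank_ker (inMap X j)
  rw [LinearMap.range_eq_top.2 hX, finrank_top,
    ← LinearEquiv.finrank_map_eq N (LinearMap.ker (inMap X j)), h1,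
    LinearMap.finrank_range_of_inj hX', Module.finrank_pi_fintype] at h2
  have h3 : (Module.finrank k (X.space j) : ℤ) + Module.finrank k (X'.space j) =
      ∑ p : Nbr j, (Module.finrank k (X.space p.1) : ℤ) := by exact_mod_cast h2
  simp only [reflVec, Function.update_self, dimVec]
  linarith

end ReflData

/-! ### Orientation and reflection -/

theorem ReflData.adm {i : V} {c : List V} (hi : i ∉ c) {X X' : QuiverRep k V}
    (D : ReflData i X X') (h : Adm (i :: c) X) : Adm (c ++ [i]) X' := by
  have hne : ∀ j ∈ c, j ≠ i := by
    rintro j hj rfl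
    exact hi hj
  refine ⟨fun j hj => ?_, List.pairwise_append.2 ⟨?_, List.pairwise_singleton _ _, ?_⟩⟩
  · simp only [List.mem_append, List.mem_singleton, not_or] at hj
    have := h.support j (by simp [hj.1, hj.2])
    exact (D.e j hj.2).symm.injective.subsingleton
  · refine (List.pairwise_cons.1 h.oriented).2.imp_of_mem fun {a b} ha hb hab f => ?_
    ext x
    obtain ⟨x, rfl⟩ := (D.e a (hne a ha)).surjective x
    rw [← D.comm _ (hne b hb), hab f]
    simp
  · intro a _ b hb f
    obtain rfl := List.mem_singleton.1 hb
    exact D.source a f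

theorem ReflData.adm_back {i : V} {c : List V} (hi : i ∉ c) {X X' : QuiverRep k V}
    (D : ReflData i X X') (h : Adm (c ++ [i]) X') : Adm (i :: c) X := by
  have hne : ∀ j ∈ c, j ≠ i := by
    rintro j hj rfl
    exact hi hj
  refine ⟨fun j hj => ?_, List.pairwise_cons.2 ⟨fun b _ f => D.sink b f, ?_⟩⟩
  · simp only [List.mem_cons, not_or] at hj
    have := h.support j (by simp [hj.1, hj.2])
    exact (D.e j hj.1).injective.subsingleton
  · refine (List.pairwise_append.1 h.oriented).1.imp_of_mem fun {a b} ha hb hab f => ?_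
    ext x
    apply (D.e b (hne b hb)).injective
    rw [D.comm (hne a ha), hab f]
    simp

end QuiverRep

namespace QuiverRep

open Quiver QuiverTF

variable {k : Type u} [Field k] {V : Type v} [Quiver.{w} V]
  [∀ i : V, IsEmpty (i ⟶ i)] [HasInvolutiveReverse V] [Fintype V] [∀ i j : V, Fintype (i ⟶ j)]

/-! ### Reflecting torsion free classes -/

/-- Representations concentrated at one vertex have no nonzero maps. -/
theorem map_eq_zero_of_concentrated {X : QuiverRep k V} {i : V}
    (h : ∀ j, j ≠ i → Subsingleton (X.space j)) {a b : V} (f : a ⟶ b) : X.map f = 0 := by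
  ext x
  by_cases ha : a = i
  · have := h b (ha ▸ ne_of_hom' f)
    exact Subsingleton.elim _ _
  · have := h a ha
    rw [Subsingleton.elim x 0]
    simp

theorem Adm.of_concentrated {X : QuiverRep k V} {i : V} {c : List V} (hi : i ∈ c)
    (h : ∀ j, j ≠ i → Subsingleton (X.space j)) : Adm c X := by
  refine ⟨fun j hj => h j ?_, List.pairwise_of_forall fun _ _ f => map_eq_zero_of_concentrated h f⟩
  rintro rfl
  exact hj hi

/-- A nonzero vector `v` of `X` at the sink `i` spans a copy of `S_i`. The coordinates of `K_i`,
each multiplied by `v`, are morphisms `K → X` that are jointly injective. -/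
theorem IsTorsionFreeIn.mem_of_concentrated {i : V} {c : List V} {T : Set (QuiverRep k V)}
    (hT : IsTorsionFreeIn {X | Adm (i :: c) X} T) {X : QuiverRep k V} (hX : X ∈ T)
    (hi : Nontrivial (X.space i)) {K : QuiverRep k V}
    (hK : ∀ j, j ≠ i → Subsingleton (K.space j)) : K ∈ T := by
  obtain ⟨v, hv⟩ := exists_ne (0 : X.space i)
  let b := Module.finBasis k (K.space i)
  have h1 : ∀ m, ∃ π : Hom K X, ∀ x, π.app i x = b.coord m x • v := by
    intro m
    obtain ⟨f, hf, -⟩ := exists_family (P := fun j => K.space j →ₗ[k] X.space j) i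
      ((b.coord m).smulRight v) fun _ _ => 0
    refine ⟨⟨f, fun {a c} h x => ?_⟩, fun x => ?_⟩
    · rw [map_eq_zero_of_concentrated hK h]
      by_cases ha : a = i
      · subst ha
        rw [(hT.subset hX).isSink c h]
        simp
      · have := hK a ha
        rw [Subsingleton.elim x 0]
        simp
    · exact LinearMap.congr_fun hf x
  choose π hπ using h1
  refine hT.mem_of_jointly_injective π ?_ (Adm.of_concentrated (by simp) hK) (fun _ => hX)
    fun f hf hY => Adm.sub f hf hY
  intro j x hx
  by_cases hj : j = i
  · subst hj
    apply b.ext_elem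
    intro m
    have := hx m
    rw [hπ, smul_eq_zero] at this
    rw [map_zero]
    exact this.resolve_right hv
  · have := hK j hj
    exact Subsingleton.elim _ _

/-- The class of representations whose reflection lies in `T`. -/
def reflUp (i : V) (c : List V) (T : Set (QuiverRep k V)) : Set (QuiverRep k V) :=
  {X | Adm (i :: c) X ∧ ∃ X' ∈ T, Nonempty (ReflData i X X')}

/-- The class of reflections of the representations in `T`. -/
def reflDown (i : V) (c : List V) (T : Set (QuiverRep k V)) : Set (QuiverRep k V) :=
  {X' | Adm (c ++ [i]) X' ∧ Function.Injective (outMap X' i) ∧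
    ∃ X ∈ T, Function.Surjective (inMap X i) ∧ Nonempty (ReflData i X X')}

/-- The kernel reflection is left exact, and membership in `T` passes along left exact sequences.
The simple representation at `i` enters the class because its reflection is zero. -/
theorem isTorsionFreeIn_reflUp {i : V} {c : List V} (hi : i ∉ c) {T : Set (QuiverRep k V)}
    (hT : IsTorsionFreeIn {X | Adm (c ++ [i]) X} T)
    (hinj : ∀ X ∈ T, Function.Injective (outMap X i)) :
    IsTorsionFreeIn {X | Adm (i :: c) X} (reflUp i c T) where
  subset X hX := hX.1
  zero_mem X hX := by
    obtain ⟨X', ⟨D⟩, hX'⟩ := ReflData.exists_kernel (i := i) (Adm.of_isZero (c := i :: c) hX).isSink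
    exact ⟨Adm.of_isZero hX, X', hT.zero_mem _ (D.isZero hX' hX), ⟨D⟩⟩
  sub_mem {X Y} f hf hY := by
    obtain ⟨hYc, Y', hY', ⟨DY⟩⟩ := hY
    have hXc := hYc.sub f hf
    obtain ⟨X', ⟨DX⟩, hX'⟩ := ReflData.exists_kernel hXc.isSink
    obtain ⟨f', hf'⟩ := DX.exists_hom DY (hinj _ hY') f
    exact ⟨hXc, X', hT.sub_mem f' (DX.injective_hom DY hf' hX' hf) hY', ⟨DX⟩⟩
  ext_mem {X Y Z} f g hf hfg _ hY hX hZ := by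
    obtain ⟨-, X', hX', ⟨DX⟩⟩ := hX
    obtain ⟨-, Z', hZ', ⟨DZ⟩⟩ := hZ
    have hYc : Adm (i :: c) Y := hY
    obtain ⟨Y', ⟨DY⟩, hY'⟩ := ReflData.exists_kernel hYc.isSink
    obtain ⟨f', hf'⟩ := DX.exists_hom DY hY' f
    obtain ⟨g', hg'⟩ := DY.exists_hom DZ (hinj _ hZ') g
    exact ⟨hYc, Y', hT.mem_of_leftExact f' g' (DX.injective_hom DY hf' (hinj _ hX') hf)
      (ReflData.exact_hom DX DY DZ hY' (hinj _ hZ') hf' hg' hf hfg) (DY.adm hi hYc) hX' hZ', ⟨DY⟩⟩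

/-- Reflecting a monomorphism back can create a kernel, but only one concentrated at `i`, which lies
in `T` because `T` does not vanish at `i`. Short exact sequences of representations without
subrepresentations at `i` reflect back to left exact ones. -/
theorem isTorsionFreeIn_reflDown {i : V} {c : List V} (hi : i ∉ c) {T : Set (QuiverRep k V)}
    (hT : IsTorsionFreeIn {X | Adm (i :: c) X} T) {X₀ : QuiverRep k V} (hX₀ : X₀ ∈ T)
    (hX₀i : Nontrivial (X₀.space i)) :
    IsTorsionFreeIn {X | Adm (c ++ [i]) X} (reflDown i c T) where
  subset X hX := hX.1
  zero_mem X' hX' := by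
    have hc := Adm.of_isZero (c := c ++ [i]) hX'
    obtain ⟨X, ⟨D⟩, hX⟩ := ReflData.exists_cokernel hc.isSource
    have := hX' i
    exact ⟨hc, Function.injective_of_subsingleton _, X,
      hT.zero_mem _ (D.isZero_back hX hX'), hX, ⟨D⟩⟩
  sub_mem {X' Y'} f' hf' hY' := by
    obtain ⟨hYc, hY'i, Y, hY, hYs, ⟨DY⟩⟩ := hY'
    have hXc := hYc.sub f' hf'
    obtain ⟨X, ⟨DX⟩, hXs⟩ := ReflData.exists_cokernel hXc.isSource
    obtain ⟨f, hf⟩ := DX.exists_hom_back DY hXs f'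
    refine ⟨hXc, injective_outMap_of_hom f' hf' hY'i, X, ?_, hXs, ⟨DX⟩⟩
    refine hT.mem_of_ker_mem f (DX.adm_back hi hXc) ?_ hY
    refine hT.mem_of_concentrated hX₀ hX₀i fun j hj => ?_
    refine Submodule.subsingleton_iff_eq_bot.2 (LinearMap.ker_eq_bot.2 ?_)
    exact (DX.injective_iff DY hf hj).1 (hf' j)
  ext_mem {X' Y' Z'} f' g' hf' hfg' hg' hY' hX' hZ' := by
    obtain ⟨-, hX'i, X, hX, hXs, ⟨DX⟩⟩ := hX'
    obtain ⟨-, hZ'i, Z, hZ, hZs, ⟨DZ⟩⟩ := hZ'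
    have hYc : Adm (c ++ [i]) Y' := hY'
    obtain ⟨Y, ⟨DY⟩, hYs⟩ := ReflData.exists_cokernel hYc.isSource
    obtain ⟨f, hf⟩ := DX.exists_hom_back DY hXs f'
    obtain ⟨g, hg⟩ := DY.exists_hom_back DZ hYs g'
    have h1 := ReflData.exact_hom_back DX DY DZ hXs hYs hZ'i hf hg hf' hfg' hg'
    refine ⟨hYc, ?_, Y, hT.mem_of_leftExact f g (fun j => (h1 j).1) (fun j => (h1 j).2)
      (DY.adm_back hi hYc) hX hZ, hYs, ⟨DY⟩⟩
    rw [injective_iff_map_eq_zero]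
    intro y hy
    have h2 : g'.app i y = 0 := by
      apply hZ'i
      rw [g'.outMap_app, hy, map_zero]
      funext p
      exact map_zero _
    obtain ⟨x, rfl⟩ := (hfg' i y).1 h2
    have h3 : x = 0 := by
      apply hX'i
      rw [map_zero]
      funext p
      apply hf'
      rw [← congrFun (f'.outMap_app i x) p, hy]
      simp
    rw [h3, map_zero]

/-! ### Words and torsion free classes -/

variable [DecidableEq V]

/-- The roots attached to a word. -/
def rootSet : List V → Set (V → ℤ)
  | [] => ∅
  | i :: ω => insert (stdVec i) (reflVec i '' rootSet ω)

/-- Words for which no simple root is repeated; these turn out to be the reduced words. -/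
def IsGood : List V → Prop
  | [] => True
  | i :: ω => IsGood ω ∧ stdVec i ∉ rootSet ω

theorem mem_rootSet_cons {i : V} {ω : List V} {β : V → ℤ} (h : β ≠ stdVec i) :
    β ∈ rootSet (i :: ω) ↔ reflVec i β ∈ rootSet ω := by
  constructor
  · rintro (h' | ⟨γ, hγ, rfl⟩)
    · exact absurd h' h
    · rwa [reflVec_reflVec]
  · intro h'
    exact Or.inr ⟨_, h', reflVec_reflVec i β⟩

/-- The torsion free class `T` is the one attached to the word `ω`. -/
structure Classifies (c ω : List V) (T : Set (QuiverRep k V)) : Prop where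
  tf : IsTorsionFreeIn {X | Adm c X} T
  mem_iff : ∀ X : QuiverRep k V, Adm c X → X.Indecomposable →
    (X ∈ T ↔ X.dimVec ∈ rootSet ω)
  exists_dimVec_eq : ∀ β ∈ rootSet ω, ∃ X ∈ T, X.Indecomposable ∧ X.dimVec = β
  unique : ∀ X Y : QuiverRep k V, Adm c X → Adm c Y → X.Indecomposable → Y.Indecomposable →
    X.dimVec = Y.dimVec → X.dimVec ∈ rootSet ω → Isomorphic X Y

theorem Classifies.apply_eq_zero {c ω : List V} {T : Set (QuiverRep k V)}
    (h : Classifies c ω T) {β : V → ℤ} (hβ : β ∈ rootSet ω) {i : V} (hi : i ∉ c) : β i = 0 := by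
  obtain ⟨X, hX, -, rfl⟩ := h.exists_dimVec_eq β hβ
  exact dimVec_apply_eq_zero_iff.2 ((h.tf.subset hX).support i hi)

/-- Every root of `ω` is the dimension vector of a representation supported on `c`, so it vanishes
at `i`; the new vertex contributes nothing. -/
theorem Classifies.skip {c ω : List V} {T : Set (QuiverRep k V)} (h : Classifies c ω T) {i : V}
    (hi : i ∉ c) : Classifies (i :: c) ω T := by
  have hsub : ∀ X ∈ T, Subsingleton (X.space i) := fun X hX => (h.tf.subset hX).support i hi
  have hdim : ∀ X : QuiverRep k V, X.dimVec ∈ rootSet ω → Subsingleton (X.space i) := fun X hX =>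
    dimVec_apply_eq_zero_iff.1 (h.apply_eq_zero hX hi)
  refine ⟨⟨fun X hX => Adm.cons (h.tf.subset hX) (hsub X hX), h.tf.zero_mem, h.tf.sub_mem, ?_⟩,
    fun X hX hXi => ⟨fun hXT => ?_, fun hXr => ?_⟩, h.exists_dimVec_eq, ?_⟩
  · intro X Y Z f g hf hfg hg hY hX hZ
    refine h.tf.ext_mem f g hf hfg hg (Adm.tail hY ⟨fun y y' => ?_⟩) hX hZ
    have h1 := hsub X hX
    have h2 := hsub Z hZ
    have h3 : ∀ y : Y.space i, y = 0 := fun y => by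
      obtain ⟨x, rfl⟩ := (hfg i y).1 (Subsingleton.elim _ _)
      rw [Subsingleton.elim x 0, map_zero]
    rw [h3 y, h3 y']
  · exact (h.mem_iff X (h.tf.subset hXT) hXi).1 hXT
  · exact (h.mem_iff X (hX.tail (hdim X hXr)) hXi).2 hXr
  · intro X Y hX hY hXi hYi hXY hXr
    exact h.unique X Y (hX.tail (hdim X hXr)) (hY.tail (hdim Y (hXY ▸ hXr))) hXi hYi hXY hXr

theorem isZero_of_concentrated {X X' : QuiverRep k V} {i : V} (D : ReflData i X X')
    (hX' : Function.Injective (outMap X' i)) (h : ∀ j, j ≠ i → Subsingleton (X.space j)) :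
    X'.IsZero := by
  have h1 : ∀ j, j ≠ i → Subsingleton (X'.space j) := fun j hj => by
    have := h j hj
    exact (D.e j hj).symm.injective.subsingleton
  intro j
  by_cases hj : j = i
  · subst hj
    have := fun p : Nbr j => h1 p.1 p.ne
    exact hX'.subsingleton
  · exact h1 j hj

/-- A vector at `i` killed by `outMap` would put the simple representation at `i` into `T`, against
`e_i ∉ rootSet ω`. So all of `T` reflects, and each indecomposable of the new class is either simple
at `i` or the reflection of one in `T`. -/
theorem Classifies.take {c ω : List V} {T : Set (QuiverRep k V)} {i : V}
    (h : Classifies (c ++ [i]) ω T) (hi : i ∉ c) (hω : stdVec i ∉ rootSet ω) :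
    Classifies (i :: c) (i :: ω) (reflUp i c T) := by
  have hinj : ∀ X ∈ T, Function.Injective (outMap X i) := by
    intro X hX
    rw [injective_iff_map_eq_zero]
    intro v hv
    by_contra hv0
    obtain ⟨S, f, hS, hf⟩ := exists_sub_dimVec_eq_stdVec v hv0 fun b a => by
      rw [← outMap_apply_reverse, hv]
      rfl
    have hST := h.tf.sub_mem f hf hX
    apply hω
    rw [← hS]
    exact (h.mem_iff S (h.tf.subset hST) (indecomposable_of_dimVec_eq_stdVec hS)).1 hST
  have htf := isTorsionFreeIn_reflUp hi h.tf hinj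
  have hmem : ∀ X : QuiverRep k V, Adm (i :: c) X → X.Indecomposable →
      (X ∈ reflUp i c T ↔ X.dimVec ∈ rootSet (i :: ω)) := by
    intro X hX hXi
    obtain ⟨X', ⟨D⟩, hX'⟩ := ReflData.exists_kernel hX.isSink
    rcases hXi.dimVec_eq_or_surjective hX.isSink with hd | hs
    · refine ⟨fun _ => Or.inl hd, fun _ => ⟨hX, X', h.tf.zero_mem _ ?_, ⟨D⟩⟩⟩
      exact isZero_of_concentrated D hX' fun j hj => subsingleton_of_dimVec_eq_stdVec hd hj
    · have hne : X.dimVec ≠ stdVec i := fun h' => not_surjective_of_dimVec_eq_stdVec h' hs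
      rw [mem_rootSet_cons hne, ← D.dimVec_eq hs hX',
        ← h.mem_iff X' (D.adm hi hX) (D.indecomposable hs hX' hXi)]
      constructor
      · rintro ⟨-, X'', hX'', ⟨D'⟩⟩
        exact h.tf.iso_mem (D.isomorphic D' hX' (hinj _ hX'') (Isomorphic.refl X)) hX''
      · intro h'
        exact ⟨hX, X', h', ⟨D⟩⟩
  refine ⟨htf, hmem, ?_, ?_⟩
  · rintro _ (rfl | ⟨β, hβ, rfl⟩)
    · obtain ⟨S, hS⟩ := exists_dimVec_eq_stdVec k i
      have hSi := indecomposable_of_dimVec_eq_stdVec hS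
      have hSc : Adm (i :: c) S := Adm.of_concentrated (by simp) fun j hj =>
        subsingleton_of_dimVec_eq_stdVec hS hj
      exact ⟨S, (hmem S hSc hSi).2 (Or.inl hS), hSi, hS⟩
    · obtain ⟨X', hX', hXi, rfl⟩ := h.exists_dimVec_eq β hβ
      have hXc : Adm (c ++ [i]) X' := h.tf.subset hX'
      obtain ⟨X, ⟨D⟩, hs⟩ := ReflData.exists_cokernel hXc.isSource
      refine ⟨X, ⟨D.adm_back hi hXc, X', hX', ⟨D⟩⟩,
        D.indecomposable_back hs (hinj _ hX') hXi, ?_⟩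
      rw [D.dimVec_eq hs (hinj _ hX'), reflVec_reflVec]
  · intro X Y hX hY hXi hYi hXY hXr
    by_cases hd : X.dimVec = stdVec i
    · exact isomorphic_of_dimVec_eq_stdVec hd (hXY ▸ hd)
    · have hXs := (hXi.dimVec_eq_or_surjective hX.isSink).resolve_left hd
      have hYs := (hYi.dimVec_eq_or_surjective hY.isSink).resolve_left (hXY ▸ hd)
      obtain ⟨X', ⟨DX⟩, hX'⟩ := ReflData.exists_kernel hX.isSink
      obtain ⟨Y', ⟨DY⟩, hY'⟩ := ReflData.exists_kernel hY.isSink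
      rw [mem_rootSet_cons hd, ← DX.dimVec_eq hXs hX'] at hXr
      refine DX.isomorphic_back DY hXs hYs (h.unique X' Y' (DX.adm hi hX) (DY.adm hi hY)
        (DX.indecomposable hXs hX' hXi) (DY.indecomposable hYs hY' hYi) ?_ hXr)
      rw [DX.dimVec_eq hXs hX', DY.dimVec_eq hYs hY', hXY]

/-- Every good sortable word has an associated torsion free class. -/
theorem exists_classifies (k : Type u) [Field k] {c ω : List V} (h : SortableWord c ω)
    (hc : c.Nodup) (hω : IsGood ω) : ∃ T : Set (QuiverRep k V), Classifies c ω T := by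
  induction h with
  | nil =>
    refine ⟨{X | X.IsZero}, ⟨fun X hX => Adm.of_isZero hX, fun X hX => hX,
      fun f hf hY i => ?_, ?_⟩, ?_, ?_, ?_⟩
    · have := hY i
      exact (hf i).subsingleton
    · intro X Y Z f g _ _ _ hY _ _ i
      exact Adm.support hY i (by simp)
    · intro X hX hXi
      exact absurd (fun i => hX.support i (by simp)) hXi.1
    · rintro β ⟨⟩
    · intro X Y _ _ _ _ _ h
      exact absurd h (Set.notMem_empty _)
  | skip _ ih =>
    obtain ⟨hi, hc'⟩ := List.nodup_cons.1 hc
    obtain ⟨T, hT⟩ := ih hc' hω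
    exact ⟨T, hT.skip hi⟩
  | @take i c ω _ ih =>
    obtain ⟨hi, hc'⟩ := List.nodup_cons.1 hc
    obtain ⟨T, hT⟩ := ih ((List.perm_append_singleton i c).symm.nodup hc) hω.1
    exact ⟨_, hT.take hi hω.2⟩

/-- The dimension vectors of the indecomposables in a class. -/
def dimSet (T : Set (QuiverRep k V)) : Set (V → ℤ) :=
  {β | ∃ X ∈ T, X.Indecomposable ∧ X.dimVec = β}

theorem reflDown_dimSet_subset {i : V} {c : List V} {T : Set (QuiverRep k V)} :
    reflVec i '' dimSet (reflDown i c T) ⊆ dimSet T \ {stdVec i} := by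
  rintro _ ⟨_, ⟨X', ⟨hXc, hX', X, hX, hs, ⟨D⟩⟩, hXi, rfl⟩, rfl⟩
  have h1 : reflVec i X'.dimVec = X.dimVec := by
    rw [D.dimVec_eq hs hX', reflVec_reflVec]
  rw [h1]
  exact ⟨⟨X, hX, D.indecomposable_back hs hX' hXi, rfl⟩,
    fun h' => not_surjective_of_dimVec_eq_stdVec h' hs⟩

/-- Every finite torsion free class comes from a good sortable word. -/
theorem exists_sortableWord (n : ℕ) : ∀ (c : List V), c.Nodup → ∀ T : Set (QuiverRep k V),
    IsTorsionFreeIn {X | Adm c X} T → (dimSet T).Finite → (dimSet T).ncard ≤ n →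
    ∃ ω, SortableWord c ω ∧ IsGood ω ∧ ∀ X : QuiverRep k V, Adm c X → X.Indecomposable →
      (X ∈ T ↔ X.dimVec ∈ rootSet ω) := by
  induction n using Nat.strong_induction_on with
  | _ n ihn =>
  intro c
  induction c with
  | nil =>
    intro _ T _ _ _
    refine ⟨[], .nil, trivial, fun X hX hXi => ?_⟩
    exact absurd (fun i => hX.support i (by simp)) hXi.1
  | cons i c ih =>
    intro hc T hT hfin hcard
    obtain ⟨hi, hc'⟩ := List.nodup_cons.1 hc
    -- If `T` vanishes at `i`, the vertex is dropped by the inner induction on `c`; otherwise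
    -- reflection lowers the number of dimension vectors.
    by_cases hsub : ∀ X ∈ T, Subsingleton (X.space i)
    · obtain ⟨ω, hω, hg, hmem⟩ := ih hc' T ⟨fun X hX => Adm.tail (hT.subset hX) (hsub X hX),
        hT.zero_mem, hT.sub_mem, fun f g hf hfg hg hY hX hZ => hT.ext_mem f g hf hfg hg
          (Adm.cons hY (Adm.support hY i hi)) hX hZ⟩ hfin hcard
      refine ⟨ω, .skip hω, hg, fun X hX hXi => ⟨fun hXT => ?_, fun hXr => ?_⟩⟩
      · exact (hmem X (hX.tail (hsub X hXT)) hXi).1 hXT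
      -- Realizing the roots of `ω` by representations supported on `c` shows that they vanish at
      -- `i`.
      · obtain ⟨T', hT'⟩ := exists_classifies k hω hc' hg
        exact (hmem X (hX.tail (dimVec_apply_eq_zero_iff.1 (hT'.apply_eq_zero hXr hi))) hXi).2 hXr
    · push Not at hsub
      obtain ⟨X₀, hX₀, hX₀i⟩ := hsub
      have hsimple : ∀ S : QuiverRep k V, S.dimVec = stdVec i → S ∈ T := fun S hS =>
        hT.mem_of_concentrated hX₀ hX₀i fun j hj => subsingleton_of_dimVec_eq_stdVec hS hj
      obtain ⟨S, hS⟩ := exists_dimVec_eq_stdVec k i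
      have hSd : stdVec i ∈ dimSet T :=
        ⟨S, hsimple S hS, indecomposable_of_dimVec_eq_stdVec hS, hS⟩
      have hcr : (c ++ [i]).Nodup := (List.perm_append_singleton i c).symm.nodup hc
      have hrinj : Function.Injective (reflVec i) :=
        Function.LeftInverse.injective (g := reflVec i) (reflVec_reflVec i)
      have hsubs := reflDown_dimSet_subset (i := i) (c := c) (T := T)
      have hlt : (dimSet (reflDown i c T)).ncard < (dimSet T).ncard := by
        rw [← Set.ncard_image_of_injective _ hrinj]
        exact (Set.ncard_le_ncard hsubs (hfin.sdiff)).trans_lt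
          (Set.ncard_sdiff_singleton_lt_of_mem hSd hfin)
      obtain ⟨ω, hω, hg, hmem⟩ := ihn _ (hlt.trans_le hcard) (c ++ [i]) hcr (reflDown i c T)
        (isTorsionFreeIn_reflDown hi hT hX₀ hX₀i)
        (Set.Finite.of_finite_image ((hfin.sdiff).subset hsubs) hrinj.injOn) le_rfl
      refine ⟨i :: ω, .take hω, ⟨hg, fun hr => ?_⟩, fun X hX hXi => ?_⟩
      -- If `e_i` were a root of `ω`, a representation realizing it would lie in `reflDown i c T`,
      -- although its `outMap` at `i` has zero target and cannot be injective.
      · obtain ⟨T', hT'⟩ := exists_classifies k hω hcr hg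
        obtain ⟨S, hST, hSi, hS⟩ := hT'.exists_dimVec_eq _ hr
        have h1 := (hmem S (hT'.tf.subset hST) hSi).2 (hS ▸ hr)
        have : ∀ p : Nbr i, Subsingleton (S.space p.1) := fun p =>
          subsingleton_of_dimVec_eq_stdVec hS p.ne
        have h2 : Subsingleton (S.space i) := h1.2.1.subsingleton
        rw [← dimVec_apply_eq_zero_iff, hS] at h2
        simp [stdVec] at h2
      · obtain ⟨X', ⟨D⟩, hX'⟩ := ReflData.exists_kernel hX.isSink
        rcases hXi.dimVec_eq_or_surjective hX.isSink with hd | hs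
        · exact ⟨fun _ => Or.inl hd, fun _ => hsimple X hd⟩
        · have hne : X.dimVec ≠ stdVec i := fun h' => not_surjective_of_dimVec_eq_stdVec h' hs
          rw [mem_rootSet_cons hne, ← D.dimVec_eq hs hX',
            ← hmem X' (D.adm hi hX) (D.indecomposable hs hX' hXi)]
          constructor
          · intro h'
            exact ⟨D.adm hi hX, hX', X, h', hs, ⟨D⟩⟩
          · rintro ⟨-, -, Y, hY, hYs, ⟨D'⟩⟩
            exact hT.iso_mem (D.isomorphic_back D' hs hYs (Isomorphic.refl X')) hY

end QuiverRep

namespace QuiverRep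

open Quiver QuiverTF

/-! ### Passage to the symmetrized quiver -/

section Symmetrify

variable {k : Type u} [Field k] {V : Type v} [Quiver.{w} V]

/-- A representation of a quiver, viewed as a representation of its symmetrization. -/
def extend (X : QuiverRep k V) : QuiverRep k (Symmetrify V) where
  space i := X.space i
  addCommGroup i := X.addCommGroup i
  module i := X.module i
  finite i := X.finite i
  map a := match a with
    | .inl a => X.map a
    | .inr _ => 0

/-- The restriction of a representation of the symmetrized quiver. -/
def restrict (X : QuiverRep k (Symmetrify V)) : QuiverRep k V where
  space i := X.space i
  addCommGroup i := X.addCommGroup i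
  module i := X.module i
  finite i := X.finite i
  map {i j} a := X.map (i := i) (j := j) (Sum.inl a)

/-- The restriction of a morphism. -/
def Hom.restrict {X Y : QuiverRep k (Symmetrify V)} (f : Hom X Y) :
    Hom (QuiverRep.restrict X) (QuiverRep.restrict Y) :=
  ⟨fun i => f.app i, fun {i j} a x => f.comm (i := i) (j := j) (Sum.inl a) x⟩

/-- The extension of a morphism. -/
def Hom.extend {X Y : QuiverRep k V} (f : Hom X Y) :
    Hom (QuiverRep.extend X) (QuiverRep.extend Y) :=
  ⟨fun i => f.app i, fun {i j} a x => by
    rcases a with a | a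
    · exact f.comm a x
    · exact (fun l : V => map_zero (f.app l)) j⟩

theorem Isomorphic.restrict {X Y : QuiverRep k (Symmetrify V)} (h : Isomorphic X Y) :
    Isomorphic (QuiverRep.restrict X) (QuiverRep.restrict Y) := by
  obtain ⟨f, hf⟩ := h
  exact ⟨f.restrict, hf⟩

theorem Isomorphic.extend {X Y : QuiverRep k V} (h : Isomorphic X Y) :
    Isomorphic (QuiverRep.extend X) (QuiverRep.extend Y) := by
  obtain ⟨f, hf⟩ := h
  exact ⟨f.extend, hf⟩

theorem extend_prod (X Y : QuiverRep k V) :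
    Isomorphic (extend (X.prod Y)) ((extend X).prod (extend Y)) := by
  refine ⟨⟨fun i : V => LinearMap.id (M := X.space i × Y.space i), fun {i j} a x => ?_⟩,
    fun i => Function.bijective_id⟩
  rcases a with a | a
  · rfl
  · rfl

theorem indecomposable_extend_iff (X : QuiverRep k V) :
    (extend X).Indecomposable ↔ X.Indecomposable := by
  constructor
  · rintro ⟨h, h'⟩
    exact ⟨h, fun A B hAB => h' (extend A) (extend B) (hAB.extend.trans (extend_prod A B))⟩
  · rintro ⟨h, h'⟩
    exact ⟨h, fun A B hAB => h' (restrict A) (restrict B) hAB.restrict⟩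

theorem adm_extend {c : List V} (hc : IsCoxeterWord c) (X : QuiverRep k V) :
    Adm (V := Symmetrify V) c (extend X) := by
  refine ⟨fun j hj => absurd (hc.mem j) hj, hc.oriented.imp fun {i j} h a => ?_⟩
  rcases a with a | a
  · exact (h.false a).elim
  · rfl

/-- An arrow `j ⟶ i` of the quiver forces `i` before `j` in `c`, so its formal reverse runs from an
earlier to a later entry and acts as zero. -/
theorem isomorphic_extend_restrict [IsAcyclic V] {c : List V} (hc : IsCoxeterWord c)
    {X : QuiverRep k (Symmetrify V)} (hX : Adm (V := Symmetrify V) c X) :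
    Isomorphic (extend (restrict X)) X := by
  have key : ∀ (i j : V) (a : j ⟶ i), X.map (i := i) (j := j) (Sum.inr a) = 0 := by
    intro i j a
    have hij : i ≠ j := by
      rintro rfl
      exact (IsAcyclic.isEmpty_loop i).false a
    -- The relation is made symmetric so that it holds for distinct vertices in whichever order they
    -- occur in `c`.
    let S : V → V → Prop := fun i j =>
      (∀ a : j ⟶ i, X.map (i := i) (j := j) (Sum.inr a) = 0) ∧
        ∀ a : i ⟶ j, X.map (i := j) (j := i) (Sum.inr a) = 0
    have hS : c.Pairwise S := hc.oriented.imp₂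
      (fun i j h h' => ⟨fun a => h' (Sum.inr a), fun a => (h.false a).elim⟩) hX.oriented
    have : Std.Symm S := ⟨fun i j h => ⟨h.2, h.1⟩⟩
    exact (hS.forall (hc.mem i) (hc.mem j) hij).1 a
  refine ⟨⟨fun i => LinearMap.id (M := X.space i), fun {i j} a x => ?_⟩,
    fun i => Function.bijective_id⟩
  rcases a with a | a
  · rfl
  · have := key i j a
    exact (LinearMap.congr_fun this x).symm

theorem isTorsionFreeIn_of_isTorsionFreeClass (c : List V) {T : Set (QuiverRep k V)}
    (hT : IsTorsionFreeClass T) :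
    IsTorsionFreeIn {X | Adm (V := Symmetrify V) c X}
      {X | Adm (V := Symmetrify V) c X ∧ restrict X ∈ T} where
  subset _ hX := hX.1
  zero_mem _ hX := ⟨Adm.of_isZero hX, hT.zero_mem _ hX⟩
  sub_mem f hf hY := ⟨hY.1.sub f hf, hT.sub_mem _ _ f.restrict hf hY.2⟩
  ext_mem f g hf hfg hg hY hX hZ :=
    ⟨hY, hT.ext_mem _ _ _ f.restrict g.restrict hf hfg hg hX.2 hZ.2⟩

theorem isTorsionFreeClass_of_isTorsionFreeIn {c : List V} (hc : IsCoxeterWord c)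
    {T : Set (QuiverRep k (Symmetrify V))}
    (hT : IsTorsionFreeIn {X | Adm (V := Symmetrify V) c X} T) :
    IsTorsionFreeClass {X : QuiverRep k V | extend X ∈ T} where
  zero_mem X hX := hT.zero_mem _ hX
  prod_mem X Y hX hY := by
    refine hT.ext_mem (inlHom X Y).extend (sndHom X Y).extend (inlHom_injective X Y)
      (fun i : V => ?_) (sndHom_surjective X Y) (adm_extend hc _) hX hY
    exact Function.Exact.inl_snd (R := k) (M := X.space i) (N := Y.space i)
  sub_mem _ _ f hf hY := hT.sub_mem f.extend hf hY
  ext_mem _ _ _ f g hf hfg hg hX hZ :=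
    hT.ext_mem f.extend g.extend hf hfg hg (adm_extend hc _) hX hZ

end Symmetrify

/-! ### Comparison of the Weyl group with reflections on the symmetrized quiver. -/

section Main

variable {k : Type u} [Field k] {V : Type v} [Fintype V] [DecidableEq V] [Quiver.{w} V]
  [∀ i j : V, Finite (i ⟶ j)] [IsAcyclic V]

instance : Fintype (Symmetrify V) := inferInstanceAs (Fintype V)

instance : DecidableEq (Symmetrify V) := inferInstanceAs (DecidableEq V)

noncomputable instance (i j : Symmetrify V) : Fintype (i ⟶ j) :=
  have h : ∀ i j : V, Finite ((i ⟶ j) ⊕ (j ⟶ i)) := fun _ _ => inferInstance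
  have : Finite (i ⟶ j) := h i j
  Fintype.ofFinite _

instance (i : Symmetrify V) : IsEmpty (i ⟶ i) :=
  ⟨fun a => (IsAcyclic.isEmpty_loop (V := V) i).false (Sum.elim id id a)⟩

theorem card_symmetrify_hom (i j : Symmetrify V) :
    Fintype.card (i ⟶ j) =
      Nat.card (Quiver.Hom (V := V) j i) + Nat.card (Quiver.Hom (V := V) i j) := by
  have h : ∀ i j : V, Nat.card ((i ⟶ j) ⊕ (j ⟶ i)) = Nat.card (j ⟶ i) + Nat.card (i ⟶ j) := by
    intro i j
    rw [Nat.card_sum, add_comm]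
  rw [← Nat.card_eq_fintype_card]
  exact h i j

/-- Between distinct vertices, the number of arrows of the symmetrized quiver is minus the entry of
the symmetrized form. -/
theorem simpleReflection_eq_reflVec (i : V) (x : V → ℤ) :
    simpleReflection i x = reflVec (V := Symmetrify V) i x := by
  funext j
  by_cases hj : j = i
  swap
  · rw [simpleReflection_apply_of_ne hj]
    exact (Function.update_of_ne (β := fun _ : Symmetrify V => ℤ) hj _ _).symm
  subst hj
  have h1 : reflVec (V := Symmetrify V) j x j =
      ∑ b : V, ((Nat.card (j ⟶ b) + Nat.card (b ⟶ j) : ℕ) : ℤ) * x b - x j :=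
    (reflVec_apply_self (V := Symmetrify V) j x).trans <| congrArg (· - x j) <|
      Finset.sum_congr rfl fun b _ =>
        congrArg (fun n : ℕ => (n : ℤ) * x b) (card_symmetrify_hom (V := V) b j)
  rw [h1, simpleReflection_apply, Pi.sub_apply, Pi.smul_apply, symForm_stdVec_apply]
  simp only [stdVec, Pi.single_eq_same, smul_eq_mul, mul_one, Nat.cast_add]
  ring

theorem wordInv_eq_rootSet (ω : List V) : wordInv ω = rootSet (V := Symmetrify V) ω := by
  induction ω with
  | nil => exact wordInv_nil
  | cons i ω ih =>
    rw [wordInv_cons, ih, funext (simpleReflection_eq_reflVec i)]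
    rfl

theorem isReduced_iff_isGood (ω : List V) :
    IsReduced ω ↔ IsGood (V := Symmetrify V) ω := by
  induction ω with
  | nil => exact iff_of_true isReduced_nil trivial
  | cons i ω ih =>
    rw [isReduced_cons_iff, ih, wordInv_eq_rootSet]
    rfl

/-- The projections to the summands are jointly injective, so sums of members of `T` are in `T`;
conversely the summands of a member are subrepresentations of it. -/
theorem classOf_wordProd {c : List V} (hc : IsCoxeterWord c) {ω : List V} (hω : IsReduced ω)
    {T : Set (QuiverRep k (Symmetrify V))}
    (hT : IsTorsionFreeIn {X | Adm (V := Symmetrify V) c X} T)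
    (hmem : ∀ X : QuiverRep k (Symmetrify V), Adm (V := Symmetrify V) c X → X.Indecomposable →
      (X ∈ T ↔ X.dimVec ∈ rootSet (V := Symmetrify V) ω)) :
    classOf k (wordProd ω) = {X : QuiverRep k V | extend X ∈ T} := by
  have hmem' : ∀ X : QuiverRep k V, X.Indecomposable →
      (extend X ∈ T ↔ X.dimVec ∈ QuiverTF.inv (wordProd ω)) := fun X hX => by
    rw [hω.inv_wordProd, wordInv_eq_rootSet]
    exact hmem (extend X) (adm_extend hc X) ((indecomposable_extend_iff X).2 hX)
  ext X
  constructor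
  · rintro ⟨n, Y, hY, f, hf⟩
    have hinj : ∀ (i : V) (x : X.space i), (∀ m, (projHom Y m).app i (f.app i x) = 0) → x = 0 := by
      intro i x hx
      apply (hf i).1
      rw [map_zero]
      exact funext hx
    exact hT.mem_of_jointly_injective (fun m => ((projHom Y m).comp f).extend) hinj
      (adm_extend hc X) (fun m => (hmem' (Y m) (hY m).1).2 (hY m).2) fun f hf hY => Adm.sub f hf hY
  · intro hX
    obtain ⟨n, Y, hY, hYX, hiso⟩ := exists_isomorphic_directSum X
    refine ⟨n, Y, fun m => ⟨hY m, (hmem' (Y m) (hY m)).1 ?_⟩, hiso⟩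
    obtain ⟨f, hf⟩ := hYX m
    exact hT.sub_mem f.extend hf hX

end Main

end QuiverRep

/-! ### The bijection. -/

open QuiverTF QuiverRep

theorem mainTheorem1 {k : Type u} [Field k] {V : Type v} [Fintype V] [DecidableEq V]
    [Quiver.{w} V] [∀ i j : V, Finite (i ⟶ j)] [QuiverTF.IsAcyclic V]
    (c : List V) (hc : QuiverTF.IsCoxeterWord c) :
    Set.BijOn (QuiverRep.classOf k)
      {x : QuiverTF.weylGroup V | QuiverTF.IsSortable c x}
      {T : Set (QuiverRep k V) |
        QuiverRep.IsTorsionFreeClass T ∧ QuiverRep.IsFiniteClass T} := by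
  have hclass : ∀ ω : List V, SortableWord c ω → IsReduced ω →
      ∃ T : Set (QuiverRep k (Quiver.Symmetrify V)),
        Classifies (V := Quiver.Symmetrify V) c ω T ∧
          classOf k (wordProd ω) = {X : QuiverRep k V | extend X ∈ T} := fun ω h hω => by
    obtain ⟨T, hT⟩ := exists_classifies (V := Quiver.Symmetrify V) k h hc.nodup
      ((isReduced_iff_isGood ω).1 hω)
    exact ⟨T, hT, classOf_wordProd hc hω hT.tf hT.mem_iff⟩
  refine ⟨?_, ?_, ?_⟩
  · intro x hx
    obtain ⟨ω, h, hω, rfl⟩ := (isSortable_iff hc.nodup x).1 hx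
    obtain ⟨T, hT, heq⟩ := hclass ω h hω
    rw [heq]
    refine ⟨isTorsionFreeClass_of_isTorsionFreeIn hc hT.tf, ?_⟩
    -- One chosen indecomposable for each of the finitely many roots covers the class, by uniqueness
    -- in `Classifies`.
    choose g hg using hT.exists_dimVec_eq
    have hfin : (rootSet (V := Quiver.Symmetrify V) ω).Finite :=
      wordInv_eq_rootSet ω ▸ finite_wordInv ω
    have := hfin.to_subtype
    refine ⟨Set.range fun β : rootSet (V := Quiver.Symmetrify V) ω => restrict (g β.1 β.2),
      Set.finite_range _, fun X hX hXi => ?_⟩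
    have hXi' := (indecomposable_extend_iff X).2 hXi
    have hX' := (hT.mem_iff _ (hT.tf.subset hX) hXi').1 hX
    refine ⟨_, ⟨⟨_, hX'⟩, rfl⟩, ?_⟩
    obtain ⟨h1, h2, h3⟩ := hg _ hX'
    exact (hT.unique _ _ (hT.tf.subset hX) (hT.tf.subset h1) hXi' h2 h3.symm hX').restrict
  -- Each inversion is realized by an indecomposable of the class, so the class determines the
  -- inversion set.
  · have hsub : ∀ ω ω' : List V, SortableWord c ω → SortableWord c ω' → IsReduced ω →
        IsReduced ω' → classOf k (wordProd ω) = classOf k (wordProd ω') →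
        wordInv ω ⊆ wordInv ω' := by
      intro ω ω' h h' hω hω' heq β hβ
      obtain ⟨T, hT, h1⟩ := hclass ω h hω
      obtain ⟨T', hT', h1'⟩ := hclass ω' h' hω'
      rw [h1, h1'] at heq
      rw [wordInv_eq_rootSet] at hβ ⊢
      obtain ⟨Z, hZ, hZi, rfl⟩ := hT.exists_dimVec_eq β hβ
      have hiso := isomorphic_extend_restrict hc (hT.tf.subset hZ)
      have h2 : restrict Z ∈ {X : QuiverRep k V | extend X ∈ T} := hT.tf.iso_mem hiso hZ
      rw [heq] at h2
      exact (hT'.mem_iff _ (hT'.tf.subset h2) (hiso.symm.indecomposable hZi)).1 h2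
    intro x hx y hy hxy
    obtain ⟨ω, h, hω, rfl⟩ := (isSortable_iff hc.nodup x).1 hx
    obtain ⟨ω', h', hω', rfl⟩ := (isSortable_iff hc.nodup y).1 hy
    apply QuiverTF.inv_injective
    rw [hω.inv_wordProd, hω'.inv_wordProd]
    exact (hsub ω ω' h h' hω hω' hxy).antisymm (hsub ω' ω h' h hω' hω hxy.symm)
  · rintro T ⟨hT, S, hS, hcover⟩
    have hTin := isTorsionFreeIn_of_isTorsionFreeClass c hT
    obtain ⟨ω, h, hω, hmem⟩ := exists_sortableWord (V := Quiver.Symmetrify V) _ c hc.nodup _ hTin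
      -- The induction counts dimension vectors, so finiteness up to isomorphism is needed only
      -- through the dimension vectors of `S`.
      ((hS.image dimVec).subset (by
        rintro _ ⟨Z, ⟨hZc, hZ⟩, hZi, rfl⟩
        have hiso := isomorphic_extend_restrict (V := V) hc hZc
        obtain ⟨Y, hY, h1⟩ := hcover _ hZ
          ((indecomposable_extend_iff _).1 (hiso.symm.indecomposable hZi))
        exact ⟨Y, hY, h1.symm.dimVec_eq⟩)) le_rfl
    have hω' := (isReduced_iff_isGood (V := V) ω).2 hω
    refine ⟨wordProd (V := V) ω, (isSortable_iff hc.nodup _).2 ⟨ω, h, hω', rfl⟩, ?_⟩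
    rw [classOf_wordProd hc hω' hTin hmem]
    ext X
    exact ⟨fun hX => hX.2, fun hX => ⟨adm_extend hc X, hX⟩⟩
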